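/- Fix an integer $d\ge 1$ and monotone non-decreasing functions $b_1,\dots,b_d\colon \mathbb{Z}_{>0}\to\mathbb{Z}_{>0}$. For $n\ge 1$ let $V_n=\prod_{i=1}^d\{-b_i(n),\dots,b_i(n)\}\subset\mathbb{Z}^d$, and let $B_n$ be the graph on $V_n$ in which two vertices are adjacent if and only if their $\ell^1$ distance is $1$. Let $P_n$ be the reflected simple random walk on $B_n$: for $u,v\in V_n$ with $\|u-v\|_1=1$, where $i$ is the coordinate with $u_i\ne v_i$, put $$P_n(u,v)=\begin{cases}\frac1{2d} & \text{if } |u_i|\neq b_i(n),\\ \frac1d & \text{if } |u_i|=b_i(n),\end{cases}$$ and $P_n(u,v)=0$ for all other $u,v\in V_n$. Let $\mathfrak{d}\colon\mathbb{Z}_{>0}\to\mathbb{Z}_{\ge0}$ be a function with $\sum_{n\ge1}\mathfrak{d}(n)=\infty$, and let $T_0=0$ and $T_n=\sum_{i=1}^n\mathfrak{d}(i)$. Let $X_0=\vec 0,X_1,X_2,\dots$ be the random walk on the growing box, i.e. the Markov chain started at the origin $\vec 0$ in which the transition from $X_t$ to $X_{t+1}$ follows $P_n$ whenever $T_{n-1}\le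 t<T_n$. The origin is called recurrent if $\sum_{t=1}^\infty\Pr[X_t=\vec 0]=\infty$, and transient if this sum is finite. Theorem. The origin is recurrent if $$\sum_{n=1}^\infty\frac{\mathfrak{d}(n)-1}{|V_n|}=\infty .$$ The origin is transient if $$\sum_{n=1}^\infty\frac{\max\left\{\mathfrak{d}(n),\ \sum_{i=1}^d b_i(n)^2\,\log|V_n|\right\}}{|V_n|}<\infty .$$ -/

import Mathlib

open Filter MeasureTheory

/-- A random walk on a growing graph `(𝔡, G, P)`, on vertices taken from an ambient type `α`.
The functions of the phase `n` are used at `n ≥ 1` only. `P n` is a `V(n) × V(n)` stochastic matrix,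
written as a matrix over `α` that vanishes outside `V(n) × V(n)`. -/
structure RWoGG (α : Type*) where
  /-- the duration `𝔡(n)` of phase `n` -/
  dur : ℕ → ℕ
  /-- the graph `G(n) = (V(n), E(n))` of phase `n` (simple and undirected) -/
  G : ℕ → (⊤ : SimpleGraph α).Subgraph
  /-- the vertex sets are finite -/
  finite_verts : ∀ n, 1 ≤ n → (G n).verts.Finite
  /-- vertices and edges never disappear -/
  mono : ∀ n, 1 ≤ n → G n ≤ G (n + 1)
  /-- the transition matrix of phase `n` -/
  P : ℕ → Matrix α α ℝ
  P_nonneg : ∀ n, 1 ≤ n → ∀ u w, 0 ≤ P n u w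
  P_rowSum : ∀ n, 1 ≤ n → ∀ u ∈ (G n).verts, ∑ᶠ w ∈ (G n).verts, P n u w = 1
  P_mem : ∀ n, 1 ≤ n → ∀ u w, P n u w ≠ 0 → u ∈ (G n).verts ∧ w ∈ (G n).verts
  /-- a move is along an edge (or the walk stays) -/
  P_adj : ∀ n, 1 ≤ n → ∀ u w, P n u w ≠ 0 → u = w ∨ (G n).Adj u w

namespace RWoGG

/-- `T_n = 𝔡(1) + ⋯ + 𝔡(n)`, the end of phase `n`; `T_0 = 0`. -/
def T {α : Type*} (D : RWoGG α) (n : ℕ) : ℕ := ∑ i ∈ Finset.Icc 1 n, D.dur i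

/-- `X_0, X_1, X_2, …` is a random walk according to `D` that starts from `v ∈ V(1)`: a Markov chain
whose transition from `X_t` to `X_{t+1}` follows `P(n)` whenever `T_{n-1} ≤ t < T_n`
(below, the phase is `n + 1`). -/
structure IsWalk {α Ω : Type*} [MeasurableSpace α] [MeasurableSpace Ω] (D : RWoGG α)
    (μ : Measure Ω) (X : ℕ → Ω → α) (v : α) : Prop where
  measurable : ∀ t, Measurable (X t)
  start_mem : v ∈ (D.G 1).verts
  start : ∀ᵐ ω ∂μ, X 0 ω = v
  step : ∀ n t, D.T n ≤ t → t < D.T (n + 1) → ∀ x : ℕ → α,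
    μ.real {ω | ∀ s ≤ t + 1, X s ω = x s} =
      μ.real {ω | ∀ s ≤ t, X s ω = x s} * D.P (n + 1) (x t) (x (t + 1))

end RWoGG

/-- `v` is recurrent for `X`: the return probabilities `R(t) = Pr[X_t = v]`, `t ≥ 1`,
have an infinite sum. -/
def IsRecurrentAt {α Ω : Type*} [MeasurableSpace Ω] (μ : Measure Ω) (X : ℕ → Ω → α) (v : α) :
    Prop :=
  ∑' t : ℕ, μ {ω | X (t + 1) ω = v} = ⊤

/-- `v` is transient for `X`: the sum of the return probabilities `R(t) = Pr[X_t = v]` is finite. -/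
def IsTransientAt {α Ω : Type*} [MeasurableSpace Ω] (μ : Measure Ω) (X : ℕ → Ω → α) (v : α) :
    Prop :=
  ∑' t : ℕ, μ {ω | X t ω = v} < ⊤

/-- The vertex set of the box with side half-lengths `c i`. -/
noncomputable def boxVerts {d : ℕ} (c : Fin d → ℕ) : Finset (Fin d → ℤ) :=
  Fintype.piFinset fun i => Finset.Icc (-(c i : ℤ)) (c i)

/-- The `ℓ¹` distance on `ℤ^d`. -/
noncomputable def l1dist {d : ℕ} (x y : Fin d → ℤ) : ℤ := ∑ i, |x i - y i|

/-- The integer grid graph on the box: its edges join the vertices at `ℓ¹` distance `1`. -/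
noncomputable def boxGraph {d : ℕ} (c : Fin d → ℕ) : (⊤ : SimpleGraph (Fin d → ℤ)).Subgraph where
  verts := boxVerts c
  Adj x y := x ∈ boxVerts c ∧ y ∈ boxVerts c ∧ l1dist x y = 1
  adj_sub := by
    rintro x y ⟨-, -, h⟩
    rw [SimpleGraph.top_adj]
    rintro rfl
    simp [l1dist] at h
  edge_vert := fun h => h.1
  symm := ⟨by
    rintro x y ⟨hx, hy, h⟩
    refine ⟨hy, hx, ?_⟩
    simpa only [l1dist, abs_sub_comm] using h⟩

open Classical in
/-- The simple random walk on the box with reflection at the boundary: a step that changes the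
coordinate `i` has probability `1/d` if `|u_i| = c_i`, and `1/(2d)` otherwise. -/
noncomputable def boxP {d : ℕ} (c : Fin d → ℕ) : Matrix (Fin d → ℤ) (Fin d → ℤ) ℝ := fun u v =>
  if u ∈ boxVerts c ∧ v ∈ boxVerts c ∧ l1dist u v = 1 then
    (if ∃ i, u i ≠ v i ∧ |u i| = (c i : ℤ) then 1 / (d : ℝ) else 1 / (2 * (d : ℝ)))
  else 0

theorem mem_boxVerts {d : ℕ} {c : Fin d → ℕ} {x : Fin d → ℤ} :
    x ∈ boxVerts c ↔ ∀ i, |x i| ≤ (c i : ℤ) := by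
  simp [boxVerts, Fintype.mem_piFinset, abs_le]

theorem l1dist_eq_one_iff {d : ℕ} (u v : Fin d → ℤ) :
    l1dist u v = 1 ↔ ∃ i, v = Function.update u i (u i + 1) ∨ v = Function.update u i (u i - 1) := by
  constructor
  · intro h
    have hne : ∃ i, u i ≠ v i := by
      by_contra hcon
      push Not at hcon
      simp [l1dist, hcon] at h
    obtain ⟨i, hi⟩ := hne
    have hsplit := Finset.add_sum_erase Finset.univ (fun j => |u j - v j|) (Finset.mem_univ i)
    have hpos : 1 ≤ |u i - v i| := Int.one_le_abs (sub_ne_zero.mpr hi)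
    have hnn : ∀ j ∈ Finset.univ.erase i, 0 ≤ |u j - v j| := fun j _ => abs_nonneg _
    have hs := Finset.sum_nonneg hnn
    simp only [l1dist] at h
    have h1 : |u i - v i| = 1 := by omega
    have h0 : ∑ j ∈ Finset.univ.erase i, |u j - v j| = 0 := by omega
    have hz := (Finset.sum_eq_zero_iff_of_nonneg hnn).1 h0
    have hj : ∀ j, j ≠ i → v j = u j := by
      intro j hji
      have := hz j (Finset.mem_erase.2 ⟨hji, Finset.mem_univ j⟩)
      have := abs_eq_zero.1 this
      omega
    refine ⟨i, ?_⟩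
    rcases (abs_eq (by norm_num : (0 : ℤ) ≤ 1)).1 h1 with h2 | h2
    · right
      funext j
      by_cases hji : j = i
      · subst hji; simp; omega
      · simp [Function.update_of_ne hji, hj j hji]
    · left
      funext j
      by_cases hji : j = i
      · subst hji; simp; omega
      · simp [Function.update_of_ne hji, hj j hji]
  · rintro ⟨i, h | h⟩ <;>
    · subst h
      unfold l1dist
      rw [Finset.sum_eq_single i]
      · simp
      · intro j _ hji
        simp [Function.update_of_ne hji]
      · simp

theorem boxP_update {d : ℕ} (c : Fin d → ℕ) {u : Fin d → ℤ} (hu : u ∈ boxVerts c) (i : Fin d)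
    {e : ℤ} (he : e = 1 ∨ e = -1) :
    boxP c u (Function.update u i (u i + e)) =
      if |u i + e| ≤ (c i : ℤ) then
        (if |u i| = (c i : ℤ) then 1 / (d : ℝ) else 1 / (2 * (d : ℝ))) else 0 := by
  have h1 : l1dist u (Function.update u i (u i + e)) = 1 := by
    rw [l1dist_eq_one_iff]
    refine ⟨i, ?_⟩
    rcases he with rfl | rfl
    · exact Or.inl rfl
    · exact Or.inr rfl
  have h2 : Function.update u i (u i + e) ∈ boxVerts c ↔ |u i + e| ≤ (c i : ℤ) := by
    rw [mem_boxVerts] at *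
    constructor
    · intro h; simpa using h i
    · intro h j
      by_cases hji : j = i
      · subst hji; simpa using h
      · simpa [Function.update_of_ne hji] using hu j
  have h3 : (∃ j, u j ≠ Function.update u i (u i + e) j ∧ |u j| = (c j : ℤ)) ↔
      |u i| = (c i : ℤ) := by
    constructor
    · rintro ⟨j, hj, hj'⟩
      by_cases hji : j = i
      · subst hji; exact hj'
      · simp [Function.update_of_ne hji] at hj
    · intro h
      refine ⟨i, ?_, h⟩
      rcases he with rfl | rfl <;> simp
  unfold boxP
  simp only [h1, h2, h3, hu, true_and, and_true]

theorem boxP_rowSum {d : ℕ} (hd : 1 ≤ d) (c : Fin d → ℕ) (hc : ∀ i, 1 ≤ c i) (u : Fin d → ℤ)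
    (hu : u ∈ boxVerts c) : ∑ w ∈ boxVerts c, boxP c u w = 1 := by
  classical
  let nb : Fin d × Bool → (Fin d → ℤ) := fun p =>
    Function.update u p.1 (u p.1 + if p.2 then 1 else -1)
  have hinj : Function.Injective nb := by
    rintro ⟨i, s⟩ ⟨j, t⟩ h
    have hij : i = j := by
      by_contra hne
      have := congrFun h i
      simp only [nb, Function.update_self, Function.update_of_ne hne] at this
      split_ifs at this <;> omega
    subst hij
    have := congrFun h i
    simp only [nb, Function.update_self] at this
    cases s <;> cases t <;> simp at this ⊢
  have hsub : ∑ w ∈ boxVerts c, boxP c u w = ∑ w ∈ Finset.univ.image nb, boxP c u w := by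
    have hA : ∑ w ∈ boxVerts c, boxP c u w =
        ∑ w ∈ boxVerts c ∪ Finset.univ.image nb, boxP c u w := by
      apply Finset.sum_subset Finset.subset_union_left
      intro w _ hw
      simp [boxP, hw]
    have hB : ∑ w ∈ Finset.univ.image nb, boxP c u w =
        ∑ w ∈ boxVerts c ∪ Finset.univ.image nb, boxP c u w := by
      apply Finset.sum_subset Finset.subset_union_right
      intro w _ hw
      unfold boxP
      rw [if_neg]
      rintro ⟨-, -, h⟩
      obtain ⟨i, h | h⟩ := (l1dist_eq_one_iff u w).1 h
      · exact hw (Finset.mem_image.2 ⟨(i, true), Finset.mem_univ _, by simp [nb, h]⟩)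
      · exact hw (Finset.mem_image.2
          ⟨(i, false), Finset.mem_univ _, by simp [nb, h, sub_eq_add_neg]⟩)
    rw [hA, hB]
  rw [hsub, Finset.sum_image (fun a _ b _ h => hinj h), Fintype.sum_prod_type]
  have hd0 : (d : ℝ) ≠ 0 := by
    have : d ≠ 0 := by omega
    exact_mod_cast this
  have key : ∀ i : Fin d, ∑ s : Bool, boxP c u (nb (i, s)) = 1 / (d : ℝ) := by
    intro i
    have hui := mem_boxVerts.1 hu i
    have hci := hc i
    rw [Fintype.sum_bool]
    simp only [nb, if_true]
    rw [boxP_update c hu i (Or.inl rfl)]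
    simp only [Bool.false_eq_true, if_false]
    rw [boxP_update c hu i (Or.inr rfl)]
    by_cases hb : |u i| = (c i : ℤ)
    · rcases abs_cases (u i) with ⟨h1, h2⟩ | ⟨h1, h2⟩
      · have e1 : ¬ |u i + 1| ≤ (c i : ℤ) := by rw [abs_le]; omega
        have e2 : |u i + -1| ≤ (c i : ℤ) := by rw [abs_le]; omega
        simp [e1, e2, hb]
      · have e1 : |u i + 1| ≤ (c i : ℤ) := by rw [abs_le]; omega
        have e2 : ¬ |u i + -1| ≤ (c i : ℤ) := by rw [abs_le]; omega
        simp [e1, e2, hb]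
    · have hlt : |u i| < (c i : ℤ) := lt_of_le_of_ne hui hb
      have := abs_lt.1 hlt
      have e1 : |u i + 1| ≤ (c i : ℤ) := by rw [abs_le]; omega
      have e2 : |u i + -1| ≤ (c i : ℤ) := by rw [abs_le]; omega
      simp only [e1, e2, hb, if_true, if_false]
      field_simp
      norm_num
  simp only [key]
  simp [hd0]

/-- The reflected simple random walk on the growing box with side half-lengths `b i n`
and durations `dur n`. -/
noncomputable def boxWalk {d : ℕ} (hd : 1 ≤ d) (b : Fin d → ℕ → ℕ)
    (hb : ∀ i n, 1 ≤ n → 1 ≤ b i n) (hmono : ∀ i m n, 1 ≤ m → m ≤ n → b i m ≤ b i n)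
    (dur : ℕ → ℕ) : RWoGG (Fin d → ℤ) where
  dur := dur
  G n := boxGraph fun i => b i n
  finite_verts n _ := (boxVerts fun i => b i n).finite_toSet
  mono n hn := by
    have hsub : ∀ x, x ∈ boxVerts (fun i => b i n) → x ∈ boxVerts (fun i => b i (n + 1)) := by
      intro x hx
      rw [mem_boxVerts] at *
      intro i
      have h1 := hx i
      have h2 := hmono i n (n + 1) hn (Nat.le_succ n)
      omega
    exact ⟨fun x hx => hsub x hx, fun x y h => ⟨hsub x h.1, hsub y h.2.1, h.2.2⟩⟩
  P n := boxP fun i => b i n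
  P_nonneg n _ u w := by
    unfold boxP
    split_ifs <;> positivity
  P_rowSum n hn u hu := by
    have h := boxP_rowSum hd (fun i => b i n) (fun i => hb i n hn) u hu
    rw [← h]
    exact finsum_mem_coe_finset (fun w => boxP (fun i => b i n) u w) (boxVerts fun i => b i n)
  P_mem n _ u w h := by
    by_contra hcon
    refine h ?_
    unfold boxP
    rw [if_neg]
    rintro ⟨h1, h2, -⟩
    exact hcon ⟨h1, h2⟩
  P_adj n _ u w h := by
    right
    by_contra hcon
    refine h ?_
    unfold boxP
    rw [if_neg]
    exact hcon

/-! Both halves rest on monotonicity: enlarging the boxes can only lower the probability of being at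
the origin. Order vertices by `AbsLE` (same parities, coordinatewise closer to the origin). One step
preserves the class of functions decreasing along this order (`BoxAnti.boxAvg`). Where a smaller box
reflects and a larger one does not, the larger box sends the walk two units further out, which
lowers the averages of such functions (`BoxAnti.boxAvg_le`). Induction on time then compares two
growing families (`boxIter_single_le`).

This reduces everything to fixed boxes. On functions even in each coordinate, the reflected walk
acts like simple random walk on the torus with sides `2 * c i`, which Fourier analysis diagonalises.
The kernel into the origin is at least the inverse torus volume at the origin at even times
(`boxKernel_even_ge`). At times `s ≥ 1` it is at most a constant depending on `d` times `∏ i, max (1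
/ c i) (1 / √s)` (`boxKernel_le`).

Recurrence: compare with the walk confined from the start to the box of the last step. Each even
time in a phase contributes at least the inverse volume, and at least half of `dur - 1` times in a
phase are even.

Transience: compare with the walk whose box stops growing at a chosen time. Stretch phase `n` to
length at least `Q n`, the sum of the squared sides, which is the order of the mixing time. During
the first `Q n` steps of the next phase, the old box still gives a bound of order its inverse
volume. At a later offset `s`, count the sides of the new box of length at least `√s`. If there are
three or more, the bound decays like `s ^ (-3/2)`, which is summable. If there are at most two, it
costs a factor `max 1 (Q (n + 1) / s)`, whose harmonic sum produces the logarithm. -/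

/-! ### The reflected walk as an averaging operator -/

/-- The neighbour of `u` in direction `e` of the coordinate `i`, reflected at the boundary. -/
noncomputable def reflStep {d : ℕ} (c : Fin d → ℕ) (u : Fin d → ℤ) (i : Fin d) (e : ℤ) :
    Fin d → ℤ :=
  Function.update u i (if |u i + e| ≤ (c i : ℤ) then u i + e else u i - e)

/-- The transition operator of the reflected walk, acting on functions. -/
noncomputable def boxAvg {d : ℕ} (c : Fin d → ℕ) (f : (Fin d → ℤ) → ℝ) (u : Fin d → ℤ) : ℝ :=
  (∑ i, (f (reflStep c u i 1) + f (reflStep c u i (-1)))) / (2 * d)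

theorem boxVerts_mono {d : ℕ} {c c' : Fin d → ℕ} (h : c ≤ c') {u : Fin d → ℤ}
    (hu : u ∈ boxVerts c) : u ∈ boxVerts c' := by
  rw [mem_boxVerts] at *
  intro i
  have h1 := hu i
  have h2 : c i ≤ c' i := h i
  omega

theorem zero_mem_boxVerts {d : ℕ} (c : Fin d → ℕ) : (0 : Fin d → ℤ) ∈ boxVerts c := by
  rw [mem_boxVerts]
  intro i
  simp

theorem reflStep_mem {d : ℕ} {c : Fin d → ℕ} (hc : ∀ i, 1 ≤ c i) {u : Fin d → ℤ}
    (hu : u ∈ boxVerts c) (i : Fin d) {e : ℤ} (he : e = 1 ∨ e = -1) :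
    reflStep c u i e ∈ boxVerts c := by
  rw [mem_boxVerts] at *
  intro j
  by_cases hji : j = i
  · subst hji
    have h1 := hu j
    have h2 := hc j
    simp only [reflStep, Function.update_self]
    split_ifs with h
    · exact h
    · rw [abs_le] at *
      omega
  · simpa [reflStep, Function.update_of_ne hji] using hu j

/-- At a boundary coordinate the weight `1/d` of the single inward move is split into two halves,
one for each sign in `reflStep`. -/
theorem sum_boxP_mul {d : ℕ} (c : Fin d → ℕ) (hc : ∀ i, 1 ≤ c i)
    {u : Fin d → ℤ} (hu : u ∈ boxVerts c) {W : Finset (Fin d → ℤ)} (hW : boxVerts c ⊆ W)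
    (f : (Fin d → ℤ) → ℝ) : ∑ w ∈ W, boxP c u w * f w = boxAvg c f u := by
  classical
  let nb : Fin d × Bool → (Fin d → ℤ) := fun p =>
    Function.update u p.1 (u p.1 + if p.2 then 1 else -1)
  have hinj : Function.Injective nb := by
    rintro ⟨i, s⟩ ⟨j, t⟩ h
    have hij : i = j := by
      by_contra hne
      have := congrFun h i
      simp only [nb, Function.update_self, Function.update_of_ne hne] at this
      split_ifs at this <;> omega
    subst hij
    have := congrFun h i
    simp only [nb, Function.update_self] at this
    cases s <;> cases t <;> simp at this ⊢
  have hsub : ∑ w ∈ W, boxP c u w * f w = ∑ w ∈ Finset.univ.image nb, boxP c u w * f w := by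
    have hA : ∑ w ∈ W, boxP c u w * f w =
        ∑ w ∈ W ∪ Finset.univ.image nb, boxP c u w * f w := by
      apply Finset.sum_subset Finset.subset_union_left
      intro w _ hw
      have : w ∉ boxVerts c := fun h => hw (hW h)
      simp [boxP, this]
    have hB : ∑ w ∈ Finset.univ.image nb, boxP c u w * f w =
        ∑ w ∈ W ∪ Finset.univ.image nb, boxP c u w * f w := by
      apply Finset.sum_subset Finset.subset_union_right
      intro w _ hw
      unfold boxP
      rw [if_neg, zero_mul]
      rintro ⟨-, -, h⟩
      obtain ⟨i, h | h⟩ := (l1dist_eq_one_iff u w).1 h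
      · exact hw (Finset.mem_image.2 ⟨(i, true), Finset.mem_univ _, by simp [nb, h]⟩)
      · exact hw (Finset.mem_image.2
          ⟨(i, false), Finset.mem_univ _, by simp [nb, h, sub_eq_add_neg]⟩)
    rw [hA, hB]
  rw [hsub, Finset.sum_image (fun a _ b _ h => hinj h), Fintype.sum_prod_type]
  have key : ∀ i : Fin d, ∑ s : Bool, boxP c u (nb (i, s)) * f (nb (i, s)) =
      (f (reflStep c u i 1) + f (reflStep c u i (-1))) / (2 * d) := by
    intro i
    have hd0 : (d : ℝ) ≠ 0 := by
      have : d ≠ 0 := fun h => by subst h; exact i.elim0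
      exact_mod_cast this
    have hui := mem_boxVerts.1 hu i
    have hci := hc i
    rw [Fintype.sum_bool]
    simp only [nb, if_true, Bool.false_eq_true, if_false, reflStep]
    rw [boxP_update c hu i (Or.inl rfl), boxP_update c hu i (Or.inr rfl)]
    by_cases hb : |u i| = (c i : ℤ)
    · rcases abs_cases (u i) with ⟨h1, h2⟩ | ⟨h1, h2⟩
      · have e1 : ¬ |u i + 1| ≤ (c i : ℤ) := by rw [abs_le]; omega
        have e2 : |u i + -1| ≤ (c i : ℤ) := by rw [abs_le]; omega
        simp only [e1, e2, hb, if_true, if_false, sub_eq_add_neg]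
        field_simp
        ring
      · have e1 : |u i + 1| ≤ (c i : ℤ) := by rw [abs_le]; omega
        have e2 : ¬ |u i + -1| ≤ (c i : ℤ) := by rw [abs_le]; omega
        simp only [e1, e2, hb, if_true, if_false, sub_neg_eq_add]
        field_simp
        ring
    · have hlt : |u i| < (c i : ℤ) := lt_of_le_of_ne hui hb
      have := abs_lt.1 hlt
      have e1 : |u i + 1| ≤ (c i : ℤ) := by rw [abs_le]; omega
      have e2 : |u i + -1| ≤ (c i : ℤ) := by rw [abs_le]; omega
      simp only [e1, e2, hb, if_true, if_false]
      field_simp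
  simp only [key, boxAvg, Finset.sum_div]

/-! ### Monotonicity in the box -/

/-- `u` and `v` have the same coordinatewise parities and `u` is coordinatewise at least as close
to the origin. -/
def AbsLE {d : ℕ} (u v : Fin d → ℤ) : Prop := ∀ j, |u j| ≤ |v j| ∧ (2 : ℤ) ∣ v j - u j

/-- On the box `c`, the function `f` is non-increasing for the order `AbsLE`. -/
def BoxAnti {d : ℕ} (c : Fin d → ℕ) (f : (Fin d → ℤ) → ℝ) : Prop :=
  ∀ u v, AbsLE u v → v ∈ boxVerts c → f v ≤ f u

theorem BoxAnti.mono {d : ℕ} {c c' : Fin d → ℕ} {f : (Fin d → ℤ) → ℝ} (hf : BoxAnti c' f)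
    (h : c ≤ c') : BoxAnti c f :=
  fun u v huv hv => hf u v huv (boxVerts_mono h hv)

/-- A one-step coupling. Parity makes unequal absolute values differ by at least two, and this gap
absorbs any pair of moves; with equal absolute values the moves must be equal or mirrored. -/
theorem absLE_reflStep {d : ℕ} {c : Fin d → ℕ} {u v : Fin d → ℤ} (huv : AbsLE u v) (i : Fin d)
    (hci : 1 ≤ c i) (hv : |v i| ≤ (c i : ℤ)) {e e' : ℤ} (he : e = 1 ∨ e = -1)
    (he' : e' = 1 ∨ e' = -1)
    (h : |u i| + 2 ≤ |v i| ∨ (u i = v i ∧ e = e') ∨ (u i = - v i ∧ e = -e')) :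
    AbsLE (reflStep c u i e) (reflStep c v i e') := by
  intro j
  by_cases hji : j = i
  · subst hji
    have h1 := huv j
    simp only [reflStep, Function.update_self]
    simp only [abs_eq_max_neg] at *
    rcases he with rfl | rfl <;> rcases he' with rfl | rfl <;> split_ifs <;> omega
  · simpa [reflStep, Function.update_of_ne hji] using huv j

theorem BoxAnti.boxAvg {d : ℕ} {c : Fin d → ℕ} (hc : ∀ i, 1 ≤ c i) {f : (Fin d → ℤ) → ℝ}
    (hf : BoxAnti c f) : BoxAnti c (boxAvg c f) := by
  intro u v huv hv
  unfold _root_.boxAvg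
  gcongr ?_ / _
  refine Finset.sum_le_sum fun i _ => ?_
  have hvi := mem_boxVerts.1 hv i
  have m1 := reflStep_mem hc hv i (Or.inl rfl)
  have m2 := reflStep_mem hc hv i (Or.inr rfl)
  have A := fun {e e' : ℤ} => absLE_reflStep (e := e) (e' := e') huv i (hc i) hvi
  have hi := huv i
  have hcase : |u i| + 2 ≤ |v i| ∨ u i = v i ∨ u i = - v i := by
    rw [abs_eq_max_neg, abs_eq_max_neg] at *
    omega
  rcases hcase with h | h | h
  · exact add_le_add (hf _ _ (A (by simp) (by simp) (Or.inl h)) m1)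
      (hf _ _ (A (by simp) (by simp) (Or.inl h)) m2)
  · exact add_le_add (hf _ _ (A (by simp) (by simp) (Or.inr (Or.inl ⟨h, rfl⟩))) m1)
      (hf _ _ (A (by simp) (by simp) (Or.inr (Or.inl ⟨h, rfl⟩))) m2)
  · rw [add_comm]
    exact add_le_add (hf _ _ (A (by simp) (by simp) (Or.inr (Or.inr ⟨h, by simp⟩))) m2)
      (hf _ _ (A (by simp) (by simp) (Or.inr (Or.inr ⟨h, by simp⟩))) m1)

theorem boxAvg_le_boxAvg {d : ℕ} {c : Fin d → ℕ} (hc : ∀ i, 1 ≤ c i) {f g : (Fin d → ℤ) → ℝ}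
    (hfg : ∀ u ∈ boxVerts c, f u ≤ g u) {u : Fin d → ℤ} (hu : u ∈ boxVerts c) :
    boxAvg c f u ≤ boxAvg c g u := by
  unfold boxAvg
  gcongr with i
  · exact hfg _ (reflStep_mem hc hu i (Or.inl rfl))
  · exact hfg _ (reflStep_mem hc hu i (Or.inr rfl))

/-- A larger box decreases the averages of functions that decrease away from the origin. -/
theorem BoxAnti.boxAvg_le {d : ℕ} {c c' : Fin d → ℕ} (hc : ∀ i, 1 ≤ c i) (hcc : c ≤ c')
    {f : (Fin d → ℤ) → ℝ} (hf : BoxAnti c' f) {u : Fin d → ℤ} (hu : u ∈ boxVerts c) :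
    _root_.boxAvg c' f u ≤ _root_.boxAvg c f u := by
  have hc' : ∀ i, 1 ≤ c' i := fun i => (hc i).trans (hcc i)
  have key : ∀ i (e : ℤ), e = 1 ∨ e = -1 → f (reflStep c' u i e) ≤ f (reflStep c u i e) := by
    intro i e he
    refine hf _ _ ?_ (reflStep_mem hc' (boxVerts_mono hcc hu) i he)
    intro j
    by_cases hji : j = i
    · subst hji
      have h1 := mem_boxVerts.1 hu j
      have h2 : c j ≤ c' j := hcc j
      have h3 := hc j
      simp only [reflStep, Function.update_self]
      simp only [abs_eq_max_neg] at *
      rcases he with rfl | rfl <;> split_ifs <;> omega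
    · simp [reflStep, Function.update_of_ne hji]
  unfold _root_.boxAvg
  gcongr with i
  · exact key i 1 (by simp)
  · exact key i (-1) (by simp)

theorem boxAnti_single {d : ℕ} (c : Fin d → ℕ) : BoxAnti c (Pi.single 0 1) := by
  intro u v huv _
  by_cases hv : v = 0
  · have hu : u = 0 := by
      funext j
      have := (huv j).1
      simpa [hv] using this
    rw [hu, hv]
  · rw [Pi.single_apply, if_neg hv, Pi.single_apply]
    split_ifs <;> norm_num

/-- `boxIter c t f 0` is the expectation of `f (X t)`, where `X` starts at the origin and the step
from time `s` to time `s + 1` is taken in the box `c s`. -/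
noncomputable def boxIter {d : ℕ} (c : ℕ → Fin d → ℕ) : ℕ → ((Fin d → ℤ) → ℝ) → (Fin d → ℤ) → ℝ
  | 0, f => f
  | t + 1, f => boxIter c t (boxAvg (c t) f)

/-- Peeling off the last step compares boxes and functions at once. The boxes `e`, `e'` confine the
assumptions on `f` and `g` to where the walks can be; after each peeling they become the boxes of
the step just removed. -/
theorem boxIter_le_boxIter {d : ℕ} {c c' : ℕ → Fin d → ℕ} (hc : ∀ t i, 1 ≤ c t i)
    (hm : Monotone c) (hm' : Monotone c') (hcc : c ≤ c') (t : ℕ) (e e' : Fin d → ℕ)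
    (he : ∀ s < t, c s ≤ e) (he' : ∀ s < t, c' s ≤ e') {f g : (Fin d → ℤ) → ℝ}
    (hf : BoxAnti e' f) (hfg : ∀ u ∈ boxVerts e, f u ≤ g u) :
    boxIter c' t f 0 ≤ boxIter c t g 0 := by
  induction t generalizing e e' f g with
  | zero => exact hfg _ (zero_mem_boxVerts e)
  | succ t ih =>
    have hc' : ∀ i, 1 ≤ c' t i := fun i => (hc t i).trans (hcc t i)
    have hf' := hf.mono (he' t (Nat.lt_succ_self t))
    refine ih (c t) (c' t) (fun s hs => hm hs.le) (fun s hs => hm' hs.le) (hf'.boxAvg hc') ?_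
    intro u hu
    exact (hf'.boxAvg_le (hc t) (hcc t) hu).trans (boxAvg_le_boxAvg (hc t)
      (fun w hw => hfg w (boxVerts_mono (he t (Nat.lt_succ_self t)) hw)) hu)

theorem boxIter_single_le {d : ℕ} {c c' : ℕ → Fin d → ℕ} (hc : ∀ t i, 1 ≤ c t i)
    (hm : Monotone c) (hm' : Monotone c') (t : ℕ) (hcc : ∀ s < t, c s ≤ c' s) :
    boxIter c' t (Pi.single 0 1) 0 ≤ boxIter c t (Pi.single 0 1) 0 := by
  have congr : ∀ (a a' : ℕ → Fin d → ℕ) (n : ℕ) f, (∀ s < n, a s = a' s) →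
      boxIter a n f = boxIter a' n f := by
    intro a a' n
    induction n with
    | zero => intro f _; rfl
    | succ n ih =>
      intro f h
      simp only [boxIter]
      rw [h n (Nat.lt_succ_self n), ih _ fun s hs => h s (hs.trans (Nat.lt_succ_self n))]
  rcases t with _ | t
  · rfl
  -- Freezing both families at the last index used makes the comparison of boxes hold at all times.
  · rw [congr c' (fun s => c' (min s t)) (t + 1) _ fun s hs => by rw [min_eq_left (by omega)],
      congr c (fun s => c (min s t)) (t + 1) _ fun s hs => by rw [min_eq_left (by omega)]]
    refine boxIter_le_boxIter (c := fun s => c (min s t)) (c' := fun s => c' (min s t))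
      (fun s => hc _) (fun a b h => hm (by omega)) (fun a b h => hm' (by omega))
      (fun s => hcc _ (by omega)) (t + 1) (c t) (c' t) (fun s hs => hm (by omega))
      (fun s hs => hm' (by omega)) (boxAnti_single _) fun u _ => le_rfl

theorem boxIter_le {d : ℕ} (hd : 1 ≤ d) {c : ℕ → Fin d → ℕ} (hc : ∀ t i, 1 ≤ c t i)
    (hm : Monotone c) (t : ℕ) (e : Fin d → ℕ) (he : ∀ s < t, c s ≤ e) {f : (Fin d → ℤ) → ℝ}
    {K : ℝ} (hf : ∀ u ∈ boxVerts e, f u ≤ K) : boxIter c t f 0 ≤ K := by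
  induction t generalizing e f with
  | zero => exact hf _ (zero_mem_boxVerts e)
  | succ t ih =>
    refine ih (c t) (fun s hs => hm hs.le) fun u hu => ?_
    refine (boxAvg_le_boxAvg (hc t) (g := fun _ => K)
      (fun w hw => hf w (boxVerts_mono (he t (Nat.lt_succ_self t)) hw)) hu).trans ?_
    have hd0 : (d : ℝ) ≠ 0 := by
      have : d ≠ 0 := by omega
      exact_mod_cast this
    simp only [boxAvg, Finset.sum_const, Finset.card_univ, Fintype.card_fin, nsmul_eq_mul]
    apply le_of_eq
    field_simp
    ring

/-! ### Spectral formula for the kernel into the origin -/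

/-- The eigenvalue of `boxAvg` at the frequencies `π k i / c i`. -/
noncomputable def boxEigen {d : ℕ} (c : Fin d → ℕ) (k : Fin d → ℕ) : ℝ :=
  (∑ i, Real.cos (Real.pi * k i / c i)) / d

/-- The transition probabilities of the reflected walk into the origin, as a sum over the spectrum
of the eigenfunctions that are even in each coordinate. -/
noncomputable def boxKernel {d : ℕ} (c : Fin d → ℕ) (s : ℕ) (x : Fin d → ℤ) : ℝ :=
  (∑ k ∈ Fintype.piFinset fun i => Finset.range (2 * c i),
    boxEigen c k ^ s * ∏ i, Real.cos (Real.pi * k i / c i * x i)) / ∏ i, (2 * c i : ℝ)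

theorem sin_half_mul_sum_cos (a : ℝ) (n : ℕ) :
    2 * Real.sin (a / 2) * ∑ k ∈ Finset.range n, Real.cos (k * a) =
      Real.sin ((n - 1 / 2) * a) + Real.sin (a / 2) := by
  induction n with
  | zero =>
    have : ((0 : ℕ) - 1 / 2 : ℝ) * a = -(a / 2) := by push_cast; ring
    rw [this, Real.sin_neg]
    simp
  | succ n ih =>
    rw [Finset.sum_range_succ, mul_add, ih]
    have h1 : ((n + 1 : ℕ) - 1 / 2 : ℝ) * a = n * a + a / 2 := by push_cast; ring
    have h2 : (n - 1 / 2 : ℝ) * a = n * a - a / 2 := by ring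
    rw [h1, h2, Real.sin_add, Real.sin_sub]
    ring

/-- Orthogonality of the characters of `ℤ/2c`; since `|x| ≤ c`, only `x = 0` is a multiple of `2c`.
-/
theorem sum_range_cos_eq_zero {c : ℕ} {x : ℤ} (hx : x ≠ 0) (hxc : |x| ≤ c) :
    ∑ k ∈ Finset.range (2 * c), Real.cos (Real.pi * k / c * x) = 0 := by
  have hc : (0 : ℝ) < c := by
    have : (0 : ℤ) < c := (abs_pos.2 hx).trans_le hxc
    exact_mod_cast this
  set a : ℝ := Real.pi * x / c with ha
  have hs : Real.sin (a / 2) ≠ 0 := by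
    intro h
    obtain ⟨n, hn⟩ := Real.sin_eq_zero_iff.1 h
    have h1 : (n : ℝ) * (2 * c) = x := by
      rw [ha] at hn
      field_simp at hn
      linarith
    have h2 : n * (2 * c) = x := by exact_mod_cast h1
    have hn0 : n ≠ 0 := by
      rintro rfl
      simp at h2
      exact hx h2.symm
    have h3 : 1 ≤ |n| := Int.one_le_abs hn0
    have hc' : (0 : ℤ) < c := by exact_mod_cast hc
    rw [← h2, abs_mul, abs_of_pos (by omega : (0 : ℤ) < 2 * c)] at hxc
    nlinarith
  have h := sin_half_mul_sum_cos a (2 * c)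
  have h1 : (((2 * c : ℕ) : ℝ) - 1 / 2) * a = -(a / 2) + x * (2 * Real.pi) := by
    rw [ha]
    push_cast
    field_simp
    ring
  rw [h1, Real.sin_add_int_mul_two_pi, Real.sin_neg, neg_add_cancel] at h
  have h2 : ∑ k ∈ Finset.range (2 * c), Real.cos (k * a) = 0 := by
    rcases mul_eq_zero.1 h with h | h
    · exact absurd h (by simpa using hs)
    · exact h
  rw [← h2]
  refine Finset.sum_congr rfl fun k _ => ?_
  rw [ha]
  congr 1
  ring

theorem boxKernel_zero {d : ℕ} {c : Fin d → ℕ} (hc : ∀ i, 1 ≤ c i) {x : Fin d → ℤ}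
    (hx : x ∈ boxVerts c) : boxKernel c 0 x = Pi.single (M := fun _ => ℝ) 0 1 x := by
  have hpos : (0 : ℝ) < ∏ i, (2 * c i : ℝ) := by
    refine Finset.prod_pos fun i _ => ?_
    have : (0 : ℝ) < c i := by exact_mod_cast hc i
    positivity
  unfold boxKernel
  simp only [pow_zero, one_mul]
  rw [← Finset.prod_univ_sum (fun i => Finset.range (2 * c i))
    (fun i k => Real.cos (Real.pi * k / c i * x i)), Pi.single_apply]
  split_ifs with h
  · subst h
    simp only [Pi.zero_apply, Int.cast_zero, mul_zero, Real.cos_zero, Finset.sum_const,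
      Finset.card_range, nsmul_eq_mul, mul_one]
    push_cast
    exact div_self hpos.ne'
  · obtain ⟨i, hi⟩ : ∃ i, x i ≠ 0 := by
      by_contra hcon
      push Not at hcon
      exact h (funext hcon)
    rw [Finset.prod_eq_zero (Finset.mem_univ i)
      (sum_range_cos_eq_zero hi (mem_boxVerts.1 hx i)), zero_div]

/-- Reflection is invisible to these cosines: `sin (θ c) = 0` gives `cos (θ (c + 1)) = cos (θ (c -
1))`, so the addition formula holds at the boundary too. -/
theorem cos_reflStep_add {c : ℕ} (hc : 1 ≤ c) (k : ℕ) {x : ℤ} (hx : |x| ≤ c) :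
    Real.cos (Real.pi * k / c * ((if |x + 1| ≤ (c : ℤ) then x + 1 else x - 1 : ℤ) : ℝ)) +
      Real.cos (Real.pi * k / c * ((if |x + -1| ≤ (c : ℤ) then x + -1 else x - -1 : ℤ) : ℝ)) =
      2 * Real.cos (Real.pi * k / c) * Real.cos (Real.pi * k / c * x) := by
  have hc0 : (c : ℝ) ≠ 0 := by
    have : c ≠ 0 := by omega
    exact_mod_cast this
  set θ : ℝ := Real.pi * k / c with hθ
  have hsum : ∀ y : ℝ, Real.cos (θ * (y + 1)) + Real.cos (θ * (y - 1)) =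
      2 * Real.cos θ * Real.cos (θ * y) := by
    intro y
    rw [mul_add, mul_sub, mul_one, Real.cos_add, Real.cos_sub]
    ring
  have hsin : Real.sin (θ * c) = 0 := by
    have : θ * c = k * Real.pi := by rw [hθ]; field_simp
    rw [this, Real.sin_nat_mul_pi]
  rw [abs_le] at hx
  by_cases h1 : x = c
  · have e1 : ¬ |x + 1| ≤ (c : ℤ) := by rw [abs_le]; omega
    have e2 : |x + -1| ≤ (c : ℤ) := by rw [abs_le]; omega
    rw [if_neg e1, if_pos e2, h1]
    push_cast
    rw [← sub_eq_add_neg, mul_sub, mul_one, Real.cos_sub, hsin]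
    ring
  by_cases h2 : x = -c
  · have e1 : |x + 1| ≤ (c : ℤ) := by rw [abs_le]; omega
    have e2 : ¬ |x + -1| ≤ (c : ℤ) := by rw [abs_le]; omega
    rw [if_pos e1, if_neg e2, h2]
    push_cast
    rw [sub_neg_eq_add, mul_add, mul_one, mul_neg, Real.cos_add, Real.sin_neg, hsin]
    ring
  · have e1 : |x + 1| ≤ (c : ℤ) := by rw [abs_le]; omega
    have e2 : |x + -1| ≤ (c : ℤ) := by rw [abs_le]; omega
    rw [if_pos e1, if_pos e2]
    push_cast
    rw [← hsum, ← sub_eq_add_neg]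

theorem boxAvg_prod_cos {d : ℕ} {c : Fin d → ℕ} (hc : ∀ i, 1 ≤ c i) {u : Fin d → ℤ}
    (hu : u ∈ boxVerts c) (k : Fin d → ℕ) :
    boxAvg c (fun x => ∏ i, Real.cos (Real.pi * k i / c i * x i)) u =
      boxEigen c k * ∏ i, Real.cos (Real.pi * k i / c i * u i) := by
  unfold boxAvg boxEigen
  have key : ∀ i, (∏ j, Real.cos (Real.pi * k j / c j * reflStep c u i 1 j)) +
      (∏ j, Real.cos (Real.pi * k j / c j * reflStep c u i (-1) j)) =
      2 * (Real.cos (Real.pi * k i / c i) * ∏ j, Real.cos (Real.pi * k j / c j * u j)) := by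
    intro i
    have hupd : ∀ e, ∏ j, Real.cos (Real.pi * k j / c j * reflStep c u i e j) =
        Real.cos (Real.pi * k i / c i * reflStep c u i e i) *
          ∏ j ∈ Finset.univ.erase i, Real.cos (Real.pi * k j / c j * u j) := by
      intro e
      rw [← Finset.mul_prod_erase _ _ (Finset.mem_univ i)]
      congr 1
      refine Finset.prod_congr rfl fun j hj => ?_
      rw [reflStep, Function.update_of_ne (Finset.ne_of_mem_erase hj)]
    rw [hupd, hupd, ← Finset.mul_prod_erase _ (fun j => Real.cos (Real.pi * k j / c j * u j))
      (Finset.mem_univ i), ← add_mul]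
    have h := cos_reflStep_add (hc i) (k i) (mem_boxVerts.1 hu i)
    simp only [reflStep, Function.update_self]
    rw [h]
    ring
  simp only [key]
  rw [← Finset.mul_sum, ← Finset.sum_mul]
  rcases eq_or_ne (d : ℝ) 0 with h | h
  · simp [h]
  · field_simp

theorem boxAvg_boxKernel {d : ℕ} {c : Fin d → ℕ} (hc : ∀ i, 1 ≤ c i) {u : Fin d → ℤ}
    (hu : u ∈ boxVerts c) (s : ℕ) : boxAvg c (boxKernel c s) u = boxKernel c (s + 1) u := by
  have hlin : boxAvg c (boxKernel c s) u =
      (∑ k ∈ Fintype.piFinset fun i => Finset.range (2 * c i), boxEigen c k ^ s *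
        boxAvg c (fun x => ∏ i, Real.cos (Real.pi * k i / c i * x i)) u) /
        ∏ i, (2 * c i : ℝ) := by
    unfold boxAvg boxKernel
    simp only [← add_div, ← Finset.sum_div, ← Finset.sum_add_distrib, ← mul_add]
    rw [Finset.sum_comm, div_right_comm, Finset.sum_div]
    congr 1
    refine Finset.sum_congr rfl fun k _ => ?_
    rw [← Finset.mul_sum, mul_div_assoc]
  rw [hlin]
  simp only [boxAvg_prod_cos hc hu]
  unfold boxKernel
  congr 1
  refine Finset.sum_congr rfl fun k _ => ?_
  ring

theorem iterate_boxAvg_single {d : ℕ} {c : Fin d → ℕ} (hc : ∀ i, 1 ≤ c i) (s : ℕ) :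
    ∀ u ∈ boxVerts c, (boxAvg c)^[s] (Pi.single 0 1) u = boxKernel c s u := by
  induction s with
  | zero =>
    intro u hu
    exact (boxKernel_zero hc hu).symm
  | succ s ih =>
    intro u hu
    rw [Function.iterate_succ_apply', ← boxAvg_boxKernel hc hu]
    exact le_antisymm (boxAvg_le_boxAvg hc (fun w hw => (ih w hw).le) hu)
      (boxAvg_le_boxAvg hc (fun w hw => (ih w hw).ge) hu)

/-- All terms are nonnegative at even times, and the constant eigenfunction `k = 0` alone gives the
bound. -/
theorem boxKernel_even_ge {d : ℕ} (hd : 1 ≤ d) {c : Fin d → ℕ} (hc : ∀ i, 1 ≤ c i) {s : ℕ}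
    (hs : Even s) : (∏ i, (2 * c i : ℝ))⁻¹ ≤ boxKernel c s 0 := by
  have hd0 : (d : ℝ) ≠ 0 := by
    have : d ≠ 0 := by omega
    exact_mod_cast this
  unfold boxKernel
  rw [inv_eq_one_div]
  gcongr
  simp only [Pi.zero_apply, Int.cast_zero, mul_zero, Real.cos_zero, Finset.prod_const_one, mul_one]
  have h0 : (0 : Fin d → ℕ) ∈ Fintype.piFinset fun i => Finset.range (2 * c i) := by
    rw [Fintype.mem_piFinset]
    intro i
    have := hc i
    simp
    omega
  refine le_trans (le_of_eq ?_) (Finset.single_le_sum (fun k _ => hs.pow_nonneg _) h0)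
  simp [boxEigen, hd0]

/-! ### Upper bound for the kernel -/

theorem geom_sum_le_inv {q : ℝ} (h0 : 0 ≤ q) (h1 : q < 1) (n : ℕ) :
    ∑ k ∈ Finset.range n, q ^ k ≤ (1 - q)⁻¹ := by
  rw [← tsum_geometric_of_lt_one h0 h1]
  exact (summable_geometric_of_lt_one h0 h1).sum_le_tsum _ fun _ _ => by positivity

theorem sum_range_pow_natAbs_le {q : ℝ} (h0 : 0 ≤ q) (h1 : q < 1) (n m : ℕ) :
    ∑ k ∈ Finset.range n, q ^ ((k : ℤ) - m).natAbs ≤ 2 * (1 - q)⁻¹ := by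
  have hsub : ∑ k ∈ Finset.range n, q ^ ((k : ℤ) - m).natAbs ≤
      ∑ k ∈ Finset.range (m + n), q ^ ((k : ℤ) - m).natAbs :=
    Finset.sum_le_sum_of_subset_of_nonneg (Finset.range_subset_range.2 (by omega))
      fun _ _ _ => by positivity
  refine hsub.trans ?_
  rw [Finset.sum_range_add, two_mul]
  refine add_le_add ?_ ?_
  · refine le_trans ?_ (geom_sum_le_inv h0 h1 m)
    rw [← Finset.sum_range_reflect]
    refine Finset.sum_le_sum fun k hk => ?_
    rw [Finset.mem_range] at hk
    exact pow_le_pow_of_le_one h0 h1.le (by omega)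
  · refine le_trans (le_of_eq ?_) (geom_sum_le_inv h0 h1 n)
    refine Finset.sum_congr rfl fun k _ => ?_
    congr 1
    omega

/-- This is `(x |r| - 1)² ≥ 0`; it replaces Gaussian sums by geometric series. -/
theorem exp_neg_sq_le {x : ℝ} (r : ℤ) :
    Real.exp (-(x * r) ^ 2) ≤ Real.exp 1 * Real.exp (-(2 * x)) ^ r.natAbs := by
  rw [← Real.exp_nat_mul, ← Real.exp_add, Real.exp_le_exp, Nat.cast_natAbs, Int.cast_abs]
  have h : (x * r) ^ 2 = x ^ 2 * |(r : ℝ)| ^ 2 := by rw [sq_abs, mul_pow]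
  rw [h]
  linarith [sq_nonneg (x * |(r : ℝ)| - 1)]

/-- `|cos|` equals `1` only at the multiples of `π`, that is near `k = 0, c, 2c`, and `cos t ≤ 1 - 2
t² / π²` on `[-π, π]` gives a Gaussian bump at each. -/
theorem exp_neg_one_sub_abs_cos_le {y : ℝ} (hy : 0 ≤ y) {c k : ℕ} (hc : 1 ≤ c)
    (hk : k < 2 * c) :
    Real.exp (-(y * (1 - |Real.cos (Real.pi * k / c)|))) ≤
      Real.exp (-(√(2 * y) / c * (((k : ℤ) - (0 : ℕ) : ℤ) : ℝ)) ^ 2) +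
      Real.exp (-(√(2 * y) / c * (((k : ℤ) - c : ℤ) : ℝ)) ^ 2) +
      Real.exp (-(√(2 * y) / c * (((k : ℤ) - (2 * c : ℕ) : ℤ) : ℝ)) ^ 2) := by
  have hc0 : (0 : ℝ) < c := by exact_mod_cast hc
  have hpi := Real.pi_pos
  have hk' : (k : ℝ) ≤ 2 * c := by exact_mod_cast hk.le
  have hk0 : (0 : ℝ) ≤ k := by positivity
  set θ : ℝ := Real.pi * k / c with hθ
  have key : ∀ r : ℤ, |(r : ℝ)| ≤ c → |Real.cos θ| = Real.cos (Real.pi * r / c) →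
      Real.exp (-(y * (1 - |Real.cos θ|))) ≤ Real.exp (-(√(2 * y) / c * (r : ℝ)) ^ 2) := by
    intro r hr h
    have hb : |Real.pi * r / c| ≤ Real.pi := by
      rw [abs_div, abs_mul, abs_of_pos hpi, abs_of_pos hc0, div_le_iff₀ hc0]
      exact mul_le_mul_of_nonneg_left hr hpi.le
    have h1 := Real.cos_le_one_sub_mul_cos_sq hb
    rw [h, Real.exp_le_exp, neg_le_neg_iff, mul_pow, div_pow, Real.sq_sqrt (by positivity)]
    have h2 : 2 / Real.pi ^ 2 * (Real.pi * r / c) ^ 2 = 2 / c ^ 2 * (r : ℝ) ^ 2 := by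
      field_simp
    rw [h2] at h1
    calc 2 * y / c ^ 2 * (r : ℝ) ^ 2 = y * (2 / c ^ 2 * (r : ℝ) ^ 2) := by ring
      _ ≤ _ := mul_le_mul_of_nonneg_left (by linarith) hy
  have p1 := Real.exp_pos (-(√(2 * y) / c * (((k : ℤ) - (0 : ℕ) : ℤ) : ℝ)) ^ 2)
  have p2 := Real.exp_pos (-(√(2 * y) / c * (((k : ℤ) - c : ℤ) : ℝ)) ^ 2)
  have p3 := Real.exp_pos (-(√(2 * y) / c * (((k : ℤ) - (2 * c : ℕ) : ℤ) : ℝ)) ^ 2)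
  rcases abs_cases (Real.cos θ) with ⟨h, -⟩ | ⟨h, -⟩
  · by_cases hkc : k ≤ c
    · have hkc' : (k : ℝ) ≤ c := by exact_mod_cast hkc
      have := key ((k : ℤ) - (0 : ℕ)) (by push_cast; rw [abs_le]; constructor <;> linarith)
        (by rw [h, hθ]; push_cast; rw [sub_zero])
      linarith
    · have hkc' : (c : ℝ) ≤ k := by exact_mod_cast (not_le.1 hkc).le
      have := key ((k : ℤ) - (2 * c : ℕ))
        (by push_cast; rw [abs_le]; constructor <;> linarith) (by
          rw [h]
          have : Real.pi * (((k : ℤ) - (2 * c : ℕ) : ℤ) : ℝ) / c = θ - 2 * Real.pi := by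
            rw [hθ]; push_cast; field_simp
          rw [this, Real.cos_sub_two_pi])
      linarith
  · have := key ((k : ℤ) - c) (by push_cast; rw [abs_le]; constructor <;> linarith) (by
      rw [h]
      have : Real.pi * (((k : ℤ) - c : ℤ) : ℝ) / c = θ - Real.pi := by
        rw [hθ]; push_cast; field_simp
      rw [this, Real.cos_sub_pi])
    linarith

theorem inv_one_sub_exp_neg_le {x : ℝ} (hx : 0 < x) : (1 - Real.exp (-x))⁻¹ ≤ 1 + 1 / x := by
  have h1 : Real.exp (-x) ≤ 1 / (1 + x) := by
    rw [Real.exp_neg, inv_eq_one_div]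
    exact one_div_le_one_div_of_le (by positivity) (by linarith [Real.add_one_le_exp x])
  have h2 : x / (1 + x) ≤ 1 - Real.exp (-x) := by
    have : x / (1 + x) = 1 - 1 / (1 + x) := by field_simp; ring
    linarith
  calc (1 - Real.exp (-x))⁻¹ ≤ (x / (1 + x))⁻¹ := inv_anti₀ (by positivity) h2
    _ = 1 + 1 / x := by field_simp; ring

/-- Three bumps, each with sum at most `6 (1 - q)⁻¹`, where `6` comes from `e < 3` and the two sides
of the peak. The bump width is of order `c √(d / s)`. -/
theorem sum_exp_abs_cos_le {d s c : ℕ} (hd : 1 ≤ d) (hs : 1 ≤ s) (hc : 1 ≤ c) :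
    (∑ k ∈ Finset.range (2 * c),
      Real.exp (-((s / d : ℝ) * (1 - |Real.cos (Real.pi * k / c)|)))) / (2 * c) ≤
      9 * (1 + d) * max (1 / c : ℝ) (1 / √s) := by
  have hc0 : (0 : ℝ) < c := by exact_mod_cast hc
  have hd0 : (1 : ℝ) ≤ d := by exact_mod_cast hd
  have hs0 : (0 : ℝ) < s := by exact_mod_cast hs
  set y : ℝ := s / d with hy
  have hy0 : 0 < y := by positivity
  set x : ℝ := √(2 * y) / c with hx
  have hx0 : 0 < x := by positivity
  set q : ℝ := Real.exp (-(2 * x)) with hq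
  have hq1 : q < 1 := by rw [hq, Real.exp_lt_one_iff]; linarith
  have hone : ∀ m : ℕ, ∑ k ∈ Finset.range (2 * c),
      Real.exp (-(x * (((k : ℤ) - m : ℤ) : ℝ)) ^ 2) ≤ 6 * (1 - q)⁻¹ := by
    intro m
    calc _ ≤ ∑ k ∈ Finset.range (2 * c), Real.exp 1 * q ^ ((k : ℤ) - m).natAbs :=
          Finset.sum_le_sum fun k _ => exp_neg_sq_le _
      _ = Real.exp 1 * ∑ k ∈ Finset.range (2 * c), q ^ ((k : ℤ) - m).natAbs := by
          rw [Finset.mul_sum]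
      _ ≤ 3 * (2 * (1 - q)⁻¹) := by
          have := Real.exp_one_lt_three
          gcongr
          · exact sum_range_pow_natAbs_le (Real.exp_pos _).le hq1 _ _
      _ = _ := by ring
  have hsum : ∑ k ∈ Finset.range (2 * c),
      Real.exp (-(y * (1 - |Real.cos (Real.pi * k / c)|))) ≤ 18 * (1 - q)⁻¹ := by
    refine (Finset.sum_le_sum fun k hk =>
      exp_neg_one_sub_abs_cos_le hy0.le hc (Finset.mem_range.1 hk)).trans ?_
    rw [Finset.sum_add_distrib, Finset.sum_add_distrib]
    linarith [hone 0, hone c, hone (2 * c)]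
  have hinv := inv_one_sub_exp_neg_le (x := 2 * x) (by positivity)
  have hsq : 1 / (x * c) ≤ d * (1 / √s) := by
    have h1 : x * c = √(2 * y) := by rw [hx]; field_simp
    have h2 : √s / d ≤ √(2 * y) := by
      apply Real.le_sqrt_of_sq_le
      rw [div_pow, Real.sq_sqrt hs0.le, hy, div_le_iff₀ (by positivity)]
      have : 2 * (s / d : ℝ) * d ^ 2 = s * (2 * d) := by field_simp
      rw [this]
      nlinarith
    rw [h1, mul_one_div]
    calc 1 / √(2 * y) ≤ 1 / (√s / d) := one_div_le_one_div_of_le (by positivity) h2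
      _ = d / √s := by rw [one_div_div]
  calc _ ≤ 18 * (1 + 1 / (2 * x)) / (2 * c) := by
        gcongr
        exact hsum.trans (by gcongr)
    _ = 9 * (1 / c) + 9 / 2 * (1 / (x * c)) := by field_simp; ring
    _ ≤ 9 * (1 / c) + 9 * (d * (1 / √s)) := by
        have : 0 ≤ d * (1 / √s) := by positivity
        linarith
    _ ≤ 9 * max (1 / c : ℝ) (1 / √s) + 9 * (d * max (1 / c : ℝ) (1 / √s)) := by
        gcongr
        · exact le_max_left _ _
        · exact le_max_right _ _
    _ = _ := by ring

/-- The eigenvalue is an average over coordinates; `1 - m ≤ exp (-m)` turns it into a product, so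
the spectral sum factorises. -/
theorem abs_boxEigen_pow_le {d : ℕ} (hd : 1 ≤ d) (c k : Fin d → ℕ) (s : ℕ) :
    |boxEigen c k| ^ s ≤
      ∏ i, Real.exp (-((s / d : ℝ) * (1 - |Real.cos (Real.pi * k i / c i)|))) := by
  have hd0 : (0 : ℝ) < d := by exact_mod_cast hd
  set m : ℝ := (∑ i, (1 - |Real.cos (Real.pi * k i / c i)|)) / d with hm
  have h1 : |boxEigen c k| ≤ 1 - m := by
    have : 1 - m = (∑ i, |Real.cos (Real.pi * k i / c i)|) / d := by
      rw [hm, Finset.sum_sub_distrib]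
      simp
      field_simp
      ring
    rw [this, boxEigen, abs_div, abs_of_pos hd0]
    gcongr
    exact Finset.abs_sum_le_sum_abs _ _
  calc |boxEigen c k| ^ s ≤ Real.exp (-m) ^ s := by
        gcongr
        exact h1.trans (Real.one_sub_le_exp_neg m)
    _ = _ := by
        rw [← Real.exp_nat_mul, ← Real.exp_sum]
        congr 1
        rw [Finset.sum_neg_distrib, ← Finset.mul_sum, hm]
        field_simp

theorem boxKernel_le {d : ℕ} (hd : 1 ≤ d) {c : Fin d → ℕ} (hc : ∀ i, 1 ≤ c i) {s : ℕ}
    (hs : 1 ≤ s) (x : Fin d → ℤ) :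
    boxKernel c s x ≤ (9 * (1 + d) : ℝ) ^ d * ∏ i, max (1 / c i : ℝ) (1 / √s) := by
  have hpos : (0 : ℝ) < ∏ i, (2 * c i : ℝ) := by
    refine Finset.prod_pos fun i _ => ?_
    have : (0 : ℝ) < c i := by exact_mod_cast hc i
    positivity
  calc boxKernel c s x
      ≤ (∑ k ∈ Fintype.piFinset fun i => Finset.range (2 * c i),
          ∏ i, Real.exp (-((s / d : ℝ) * (1 - |Real.cos (Real.pi * k i / c i)|)))) /
          ∏ i, (2 * c i : ℝ) := by
        unfold boxKernel
        gcongr with k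
        refine (le_abs_self _).trans ?_
        rw [abs_mul, abs_pow, Finset.abs_prod]
        refine (mul_le_of_le_one_right (by positivity) ?_).trans (abs_boxEigen_pow_le hd c k s)
        exact Finset.prod_le_one (fun _ _ => abs_nonneg _) fun _ _ => Real.abs_cos_le_one _
    _ = ∏ i, (∑ j ∈ Finset.range (2 * c i),
          Real.exp (-((s / d : ℝ) * (1 - |Real.cos (Real.pi * j / c i)|)))) / (2 * c i) := by
        rw [Finset.prod_div_distrib, Finset.prod_univ_sum]
    _ ≤ ∏ i, (9 * (1 + d) * max (1 / c i : ℝ) (1 / √s)) := by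
        refine Finset.prod_le_prod (fun i _ => by positivity) fun i _ => ?_
        exact sum_exp_abs_cos_le hd hs (hc i)
    _ = _ := by
        rw [Finset.prod_mul_distrib, Finset.prod_const, Finset.card_univ, Fintype.card_fin]

/-! ### Return probabilities compared with fixed boxes -/

theorem boxIter_min_add {d : ℕ} (c : ℕ → Fin d → ℕ) (t₀ s : ℕ) (f : (Fin d → ℤ) → ℝ) :
    boxIter (fun t => c (min t t₀)) (t₀ + s) f = boxIter c t₀ ((boxAvg (c t₀))^[s] f) := by
  induction s generalizing f with
  | zero =>
    have : ∀ n ≤ t₀, ∀ f, boxIter (fun t => c (min t t₀)) n f = boxIter c n f := by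
      intro n
      induction n with
      | zero => intros; rfl
      | succ n ih =>
        intro hn f
        simp only [boxIter]
        rw [ih (by omega), min_eq_left (by omega)]
    exact this t₀ le_rfl f
  | succ s ih =>
    rw [← add_assoc]
    simp only [boxIter]
    rw [ih, min_eq_right (by omega), Function.iterate_succ_apply]

theorem boxIter_const {d : ℕ} (c : Fin d → ℕ) (t : ℕ) (f : (Fin d → ℤ) → ℝ) :
    boxIter (fun _ => c) t f = (boxAvg c)^[t] f := by
  have h := boxIter_min_add (fun _ => c) 0 t f
  rwa [zero_add] at h

/-- Upper bound for the return probability by the walk that stops growing at time `t₀`. -/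
theorem boxIter_single_le_kernel {d : ℕ} (hd : 1 ≤ d) {c : ℕ → Fin d → ℕ}
    (hc : ∀ t i, 1 ≤ c t i) (hm : Monotone c) (t₀ : ℕ) {s : ℕ} (hs : 1 ≤ s) :
    boxIter c (t₀ + s) (Pi.single 0 1) 0 ≤
      (9 * (1 + d) : ℝ) ^ d * ∏ i, max (1 / c t₀ i : ℝ) (1 / √s) := by
  refine (boxIter_single_le (c := fun t => c (min t t₀)) (fun t => hc _)
    (fun a b h => hm (by omega)) hm (t₀ + s) fun r _ => hm (by omega)).trans ?_
  rw [boxIter_min_add]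
  refine boxIter_le hd hc hm t₀ (c t₀) (fun r hr => hm hr.le) fun u hu => ?_
  rw [iterate_boxAvg_single (hc t₀) s u hu]
  exact boxKernel_le hd (hc t₀) hs u

/-- Lower bound for the return probability by the walk on the final box. -/
theorem le_boxIter_single {d : ℕ} (hd : 1 ≤ d) {c : ℕ → Fin d → ℕ}
    (hc : ∀ t i, 1 ≤ c t i) (hm : Monotone c) {t : ℕ} (ht : Even (t + 1)) :
    (∏ i, (2 * c t i : ℝ))⁻¹ ≤ boxIter c (t + 1) (Pi.single 0 1) 0 := by
  refine le_trans ?_ (boxIter_single_le (c' := fun _ => c t) hc hm monotone_const (t + 1)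
    fun r hr => hm (by omega))
  rw [boxIter_const, iterate_boxAvg_single (hc t) _ _ (zero_mem_boxVerts _)]
  exact boxKernel_even_ge hd (hc t) ht

/-! ### From the Markov chain to the operator -/

section Chain

variable {d : ℕ} {Ω : Type*} [MeasurableSpace Ω] {μ : Measure Ω} [IsProbabilityMeasure μ]
  {X : ℕ → Ω → (Fin d → ℤ)} {c : ℕ → Fin d → ℕ}

/-- The walk is given by path probabilities; summing over the countably many histories ending at `x`
yields the one-step law. -/
theorem measure_eq_and_succ_eq (hX : ∀ t, Measurable (X t)) (t : ℕ)
    (hstep : ∀ x : ℕ → (Fin d → ℤ), μ.real {ω | ∀ s ≤ t + 1, X s ω = x s} =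
      μ.real {ω | ∀ s ≤ t, X s ω = x s} * boxP (c t) (x t) (x (t + 1))) (x y : Fin d → ℤ) :
    μ (X t ⁻¹' {x} ∩ X (t + 1) ⁻¹' {y}) =
      μ (X t ⁻¹' {x}) * ENNReal.ofReal (boxP (c t) x y) := by
  let H : Ω → (Fin (t + 1) → (Fin d → ℤ)) := fun ω s => X s ω
  have hH : Measurable H := measurable_pi_lambda _ fun s => hX s
  let S : Set (Fin (t + 1) → (Fin d → ℤ)) := {h | h (Fin.last t) = x}
  have hHS : H ⁻¹' S = X t ⁻¹' {x} := by
    ext ω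
    simp [H, S]
  have e1 := tsum_measure_preimage_singleton (μ := μ) S.to_countable (f := H)
    fun h _ => hH (measurableSet_singleton h)
  have e2 := tsum_measure_preimage_singleton (μ := μ.restrict (X (t + 1) ⁻¹' {y}))
    S.to_countable (f := H) fun h _ => hH (measurableSet_singleton h)
  rw [hHS] at e1 e2
  rw [Measure.restrict_apply (hX t (measurableSet_singleton x))] at e2
  rw [← e2, ← e1, ← ENNReal.tsum_mul_right]
  refine tsum_congr fun ⟨h, hh⟩ => ?_
  rw [Measure.restrict_apply (hH (measurableSet_singleton h))]
  let p : ℕ → (Fin d → ℤ) := fun s => if hs : s < t + 1 then h ⟨s, hs⟩ else y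
  have hp := hstep p
  have s1 : {ω | ∀ s ≤ t, X s ω = p s} = H ⁻¹' {h} := by
    ext ω
    simp only [Set.mem_ofPred_eq, Set.mem_preimage, Set.mem_singleton_iff, funext_iff (f := H ω)]
    constructor
    · intro hω s
      have := hω s (by omega)
      rwa [show p s = h s from dif_pos s.2] at this
    · intro hω s hs
      rw [show p s = h ⟨s, by omega⟩ from dif_pos (by omega)]
      exact hω ⟨s, by omega⟩
  have s2 : {ω | ∀ s ≤ t + 1, X s ω = p s} = H ⁻¹' {h} ∩ X (t + 1) ⁻¹' {y} := by
    rw [← s1]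
    ext ω
    simp only [Set.mem_ofPred_eq, Set.mem_inter_iff, Set.mem_preimage, Set.mem_singleton_iff]
    constructor
    · intro hω
      refine ⟨fun s hs => hω s (by omega), ?_⟩
      simpa [p] using hω (t + 1) le_rfl
    · rintro ⟨h1, h2⟩ s hs
      rcases Nat.lt_or_ge s (t + 1) with h' | h'
      · exact h1 s (by omega)
      · obtain rfl : s = t + 1 := by omega
        simpa [p] using h2
  have p1 : p t = x := by
    have : h (Fin.last t) = x := hh
    simpa [p, Fin.last] using this
  have p2 : p (t + 1) = y := by simp [p]
  rw [s1, s2, p1, p2] at hp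
  have h0 : 0 ≤ boxP (c t) x y := by
    unfold boxP
    split_ifs <;> positivity
  rw [← ENNReal.ofReal_toReal (measure_ne_top μ (H ⁻¹' {h} ∩ X (t + 1) ⁻¹' {y})),
    ← ENNReal.ofReal_toReal (measure_ne_top μ (H ⁻¹' {h})), ← ENNReal.ofReal_mul (by positivity)]
  exact congrArg _ hp

theorem measureReal_succ_eq_sum (hX : ∀ t, Measurable (X t)) (t : ℕ)
    (hstep : ∀ x : ℕ → (Fin d → ℤ), μ.real {ω | ∀ s ≤ t + 1, X s ω = x s} =
      μ.real {ω | ∀ s ≤ t, X s ω = x s} * boxP (c t) (x t) (x (t + 1))) (y : Fin d → ℤ) :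
    μ.real (X (t + 1) ⁻¹' {y}) =
      ∑ x ∈ boxVerts (c t), μ.real (X t ⁻¹' {x}) * boxP (c t) x y := by
  have e := tsum_measure_preimage_singleton (μ := μ.restrict (X (t + 1) ⁻¹' {y}))
    (Set.univ : Set (Fin d → ℤ)).to_countable (f := X t)
    fun h _ => hX t (measurableSet_singleton h)
  rw [Set.preimage_univ, Measure.restrict_apply_univ,
    tsum_univ fun x => μ.restrict (X (t + 1) ⁻¹' {y}) (X t ⁻¹' {x})] at e
  have h0 : ∀ x, 0 ≤ boxP (c t) x y := by
    intro x
    unfold boxP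
    split_ifs <;> positivity
  have e' : μ (X (t + 1) ⁻¹' {y}) =
      ∑ x ∈ boxVerts (c t), μ (X t ⁻¹' {x}) * ENNReal.ofReal (boxP (c t) x y) := by
    rw [← e, tsum_eq_sum (s := boxVerts (c t))]
    · refine Finset.sum_congr rfl fun x _ => ?_
      rw [Measure.restrict_apply (hX t (measurableSet_singleton x)),
        measure_eq_and_succ_eq hX t hstep]
    · intro x hx
      rw [Measure.restrict_apply (hX t (measurableSet_singleton x)),
        measure_eq_and_succ_eq hX t hstep]
      simp [boxP, hx]
  rw [Measure.real, e', ENNReal.toReal_sum fun x _ =>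
    ENNReal.mul_ne_top (measure_ne_top _ _) ENNReal.ofReal_ne_top]
  refine Finset.sum_congr rfl fun x _ => ?_
  rw [ENNReal.toReal_mul, ENNReal.toReal_ofReal (h0 x), Measure.real]

theorem sum_measureReal_mul_eq_boxIter (hX : ∀ t, Measurable (X t)) (h0 : ∀ᵐ ω ∂μ, X 0 ω = 0)
    (hc : ∀ t i, 1 ≤ c t i) (hm : Monotone c)
    (hstep : ∀ t (x : ℕ → (Fin d → ℤ)), μ.real {ω | ∀ s ≤ t + 1, X s ω = x s} =
      μ.real {ω | ∀ s ≤ t, X s ω = x s} * boxP (c t) (x t) (x (t + 1))) (t : ℕ)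
    (e : Fin d → ℕ) (he : ∀ s < t, c s ≤ e) (f : (Fin d → ℤ) → ℝ) :
    ∑ x ∈ boxVerts e, μ.real (X t ⁻¹' {x}) * f x = boxIter c t f 0 := by
  induction t generalizing e f with
  | zero =>
    rw [Finset.sum_eq_single_of_mem 0 (zero_mem_boxVerts e)]
    · have : μ (X 0 ⁻¹' {0}) = 1 := by
        rw [prob_compl_eq_zero_iff (hX 0 (measurableSet_singleton 0)) |>.symm]
        exact h0
      simp [Measure.real, this, boxIter]
    · intro x _ hx
      have : μ (X 0 ⁻¹' {x}) = 0 := by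
        refine measure_mono_null ?_ (ae_iff.1 h0)
        intro ω hω hω'
        have h1 : X 0 ω = x := hω
        exact hx (h1.symm.trans hω')
      simp [Measure.real, this]
  | succ t ih =>
    simp only [boxIter]
    rw [← ih (c t) (fun s hs => hm hs.le)]
    simp only [measureReal_succ_eq_sum hX t (hstep t), Finset.sum_mul]
    rw [Finset.sum_comm]
    refine Finset.sum_congr rfl fun x hx => ?_
    rw [← sum_boxP_mul (c t) (hc t) hx fun w hw => boxVerts_mono (he t (Nat.lt_succ_self t)) hw,
      Finset.mul_sum]
    refine Finset.sum_congr rfl fun y _ => ?_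
    ring

theorem measure_eq_boxIter (hX : ∀ t, Measurable (X t)) (h0 : ∀ᵐ ω ∂μ, X 0 ω = 0)
    (hc : ∀ t i, 1 ≤ c t i) (hm : Monotone c)
    (hstep : ∀ t (x : ℕ → (Fin d → ℤ)), μ.real {ω | ∀ s ≤ t + 1, X s ω = x s} =
      μ.real {ω | ∀ s ≤ t, X s ω = x s} * boxP (c t) (x t) (x (t + 1))) (t : ℕ) :
    μ.real {ω | X t ω = 0} = boxIter c t (Pi.single 0 1) 0 := by
  rw [← sum_measureReal_mul_eq_boxIter hX h0 hc hm hstep t (c t) fun s hs => hm hs.le,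
    Finset.sum_eq_single_of_mem 0 (zero_mem_boxVerts _)]
  · simp only [Pi.single_eq_same, mul_one]
    rfl
  · intro x _ hx
    rw [Pi.single_apply, if_neg hx, mul_zero]

end Chain

/-! ### Phases, parity and elementary sums -/

/-- Times are divided into phases by an unbounded monotone sequence. -/
theorem exists_phase {T : ℕ → ℕ} (hT0 : T 0 = 0) (hmono : Monotone T)
    (hT : Tendsto T atTop atTop) :
    ∃ N : ℕ → ℕ, Monotone N ∧ ∀ t, T (N t) ≤ t ∧ t < T (N t + 1) := by
  have hex : ∀ t, ∃ n, T n ≤ t ∧ t < T (n + 1) := by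
    intro t
    classical
    have h : ∃ n, t < T n := (hT.eventually_gt_atTop t).exists
    have hn := Nat.find_spec h
    have hpos : Nat.find h ≠ 0 := by
      intro h'
      rw [h', hT0] at hn
      omega
    refine ⟨Nat.find h - 1, not_lt.1 (Nat.find_min h (by omega)), ?_⟩
    rwa [Nat.sub_add_cancel (by omega)]
  choose N hN using hex
  refine ⟨N, fun s t hst => ?_, hN⟩
  by_contra! hlt
  have h1 := hmono (show N t + 1 ≤ N s by omega)
  have h2 := hN s
  have h3 := hN t
  omega

theorem card_boxVerts {d : ℕ} (c : Fin d → ℕ) :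
    ((boxVerts c).card : ℝ) = ∏ i, (2 * c i + 1 : ℝ) := by
  rw [boxVerts, Fintype.card_piFinset]
  push_cast
  refine Finset.prod_congr rfl fun i _ => ?_
  rw [Int.card_Icc]
  have : ((c i : ℤ) + 1 - -(c i : ℤ)).toNat = 2 * c i + 1 := by omega
  rw [this]
  push_cast
  ring

/-- A quantity of size at least `w` at all times of one parity. -/
theorem sub_one_mul_le_sum_range {g : ℕ → ℝ} {w : ℝ} (hw : 0 ≤ w) (hg : ∀ j, 0 ≤ g j) (a D : ℕ)
    (h : ∀ j < D, Even (a + j) → w ≤ g j) :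
    (D - 1) * w ≤ 2 * ∑ j ∈ Finset.range D, g j := by
  -- The correction records whether the next time is even; without it the induction would not close.
  have key : D * w - (if Even (a + D) then w else 0) ≤ 2 * ∑ j ∈ Finset.range D, g j := by
    induction D with
    | zero =>
      simp only [Nat.cast_zero, zero_mul, Finset.range_zero, Finset.sum_empty, mul_zero]
      split_ifs <;> linarith
    | succ D ih =>
      have ih := ih fun j hj => h j (by omega)
      rw [Finset.sum_range_succ, Nat.cast_succ]
      by_cases hD : Even (a + D)
      · have h1 : ¬ Even (a + (D + 1)) := by rw [← add_assoc, Nat.even_add_one]; simpa using hD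
        have h2 := h D (by omega) hD
        rw [if_pos hD] at ih
        rw [if_neg h1]
        linarith
      · have h1 : Even (a + (D + 1)) := by rw [← add_assoc, Nat.even_add_one]; exact hD
        have h2 := hg D
        rw [if_neg hD] at ih
        rw [if_pos h1]
        linarith
  split_ifs at key <;> linarith

theorem inv_sqrt_cube_le {n : ℕ} (hn : 1 ≤ n) :
    (1 / √n) ^ 3 ≤ 6 * (1 / √n - 1 / √(n + 1 : ℕ)) := by
  have hn0 : (1 : ℝ) ≤ n := by exact_mod_cast hn
  set a := √(n : ℝ) with ha
  set b := √((n + 1 : ℕ) : ℝ) with hb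
  have ha1 : 1 ≤ a := Real.one_le_sqrt.2 hn0
  have ha2 : a ^ 2 = n := Real.sq_sqrt (by positivity)
  have hb2 : b ^ 2 = n + 1 := by rw [hb, Real.sq_sqrt (by positivity)]; push_cast; ring
  have hb0 : 0 < b := by rw [hb]; positivity
  have hab : a ≤ b := Real.sqrt_le_sqrt (by push_cast; linarith)
  have h1 : 1 / a - 1 / b = 1 / (a * b * (a + b)) := by
    have h : (b - a) * (a + b) = 1 := by nlinarith
    have : a ≠ 0 := by positivity
    field_simp
    linarith
  rw [h1, one_div_pow, mul_one_div, div_le_div_iff₀ (by positivity) (by positivity)]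
  have hb3 : b ≤ 2 * a := by nlinarith
  have h2 : b * (a + b) ≤ 6 * a ^ 2 := by nlinarith
  nlinarith

theorem sum_cutoff_sqrt_cube_le {Q : ℕ} (hQ : 1 ≤ Q) (n : ℕ) :
    ∑ s ∈ Finset.range n, (if s < Q then (1 : ℝ) else √(Q / s) ^ 3) ≤ 7 * Q := by
  have hQ0 : (0 : ℝ) < Q := by exact_mod_cast hQ
  have hsmall : ∀ m ≤ Q, ∑ s ∈ Finset.range m, (if s < Q then (1 : ℝ) else √(Q / s) ^ 3) = m := by
    intro m hm
    rw [Finset.sum_congr rfl fun s hs => if_pos ((Finset.mem_range.1 hs).trans_le hm)]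
    simp
  rcases le_total n Q with hn | hn
  · rw [hsmall n hn]
    have : (n : ℝ) ≤ Q := by exact_mod_cast hn
    linarith
  · have key : ∑ s ∈ Finset.range n, (if s < Q then (1 : ℝ) else √(Q / s) ^ 3) ≤
        Q + 6 * √Q ^ 3 * (1 / √Q - 1 / √n) := by
      induction n, hn using Nat.le_induction with
      | base =>
        rw [hsmall Q le_rfl]
        simp
      | succ n hn ih =>
        rw [Finset.sum_range_succ, if_neg (by omega)]
        have h := inv_sqrt_cube_le (hQ.trans hn)
        have h' := mul_le_mul_of_nonneg_left h (show 0 ≤ √(Q : ℝ) ^ 3 by positivity)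
        have h2 : √(Q / n : ℝ) ^ 3 = √(Q : ℝ) ^ 3 * (1 / √n) ^ 3 := by
          rw [Real.sqrt_div hQ0.le]
          ring
        rw [h2]
        linarith
    have h1 : √(Q : ℝ) ^ 3 * (1 / √Q) = Q := by
      have : √(Q : ℝ) ≠ 0 := by positivity
      field_simp
      exact Real.sq_sqrt hQ0.le
    have h2 : 0 ≤ √(Q : ℝ) ^ 3 * (1 / √n) := by positivity
    linarith

/-- Only `s < Q` exceeds `1`, and there the excess is harmonic. The term `s = 0` equals `1`, since
`Q / 0 = 0`. -/
theorem sum_max_one_div_le (Q n : ℕ) :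
    ∑ s ∈ Finset.range n, max (1 : ℝ) (Q / s) ≤ n + Q * (1 + Real.log Q) := by
  have h1 : ∀ s ∈ Finset.range n, max (1 : ℝ) (Q / s) ≤ 1 + (if s < Q then (Q / s : ℝ) else 0) := by
    intro s _
    split_ifs with h
    · exact max_le (by linarith [show (0 : ℝ) ≤ Q / s by positivity]) (by linarith)
    · rw [add_zero]
      refine max_le le_rfl ?_
      exact div_le_one_of_le₀ (by exact_mod_cast not_lt.1 h) (by positivity)
  refine (Finset.sum_le_sum h1).trans ?_
  rw [Finset.sum_add_distrib, ← Finset.sum_filter]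
  simp only [Finset.sum_const, Finset.card_range, nsmul_eq_mul, mul_one]
  gcongr
  have h2 : ∑ s ∈ (Finset.range n).filter (· < Q), (Q / s : ℝ) ≤
      ∑ s ∈ Finset.range (Q + 1), (Q / s : ℝ) := by
    refine Finset.sum_le_sum_of_subset_of_nonneg ?_ fun _ _ _ => by positivity
    intro s hs
    rw [Finset.mem_filter] at hs
    rw [Finset.mem_range]
    omega
  refine h2.trans ?_
  have h3 : ∑ s ∈ Finset.range (Q + 1), (Q / s : ℝ) = Q * (harmonic Q : ℝ) := by
    rw [Finset.sum_range_succ', harmonic]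
    push_cast
    simp [Finset.mul_sum, div_eq_mul_inv]
  rw [h3]
  gcongr
  exact harmonic_le_one_add_log Q

/-! ### Summing the kernel along the phases -/

/-- The heat kernel at time `s` in a box, in terms of the volumes of the box and of a smaller box
of diameter at most `√s`. -/
theorem prod_max_le {d : ℕ} {β β' : Fin d → ℕ} (hβ : ∀ i, 1 ≤ β i) (hββ : β ≤ β') {Q Q' s : ℕ}
    (hQ : ∀ i, β i ^ 2 ≤ Q) (hQ' : ∀ i, β' i ^ 2 ≤ Q') (hQs : Q ≤ s) (hs : 1 ≤ s) :
    ∏ i, max (1 / β' i : ℝ) (1 / √s) ≤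
      √(Q / s) ^ 3 * ∏ i, (1 / β i : ℝ) + max (1 : ℝ) (Q' / s) * ∏ i, (1 / β' i : ℝ) := by
  classical
  have hs0 : (0 : ℝ) < s := by exact_mod_cast hs
  have hb : ∀ i, (0 : ℝ) < β i := fun i => by exact_mod_cast hβ i
  have hbb : ∀ i, (β i : ℝ) ≤ β' i := fun i => by exact_mod_cast hββ i
  have hb' : ∀ i, (0 : ℝ) < β' i := fun i => (hb i).trans_le (hbb i)
  set I : Finset (Fin d) := Finset.univ.filter fun i => s ≤ β' i ^ 2 with hI
  have hmem : ∀ i ∈ I, √(s : ℝ) ≤ β' i := by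
    intro i hi
    have : s ≤ β' i ^ 2 := (Finset.mem_filter.1 hi).2
    rw [Real.sqrt_le_left (hb' i).le]
    exact_mod_cast this
  have hnot : ∀ i ∉ I, (β' i : ℝ) ≤ √s := by
    intro i hi
    have : β' i ^ 2 ≤ s := by
      by_contra! h
      exact hi (Finset.mem_filter.2 ⟨Finset.mem_univ i, h.le⟩)
    apply Real.le_sqrt_of_sq_le
    exact_mod_cast this
  have hprod : ∀ (x : ℝ) (g : Fin d → ℝ), ∏ i, ((if i ∈ I then x else 1) * g i) =
      x ^ I.card * ∏ i, g i := by
    intro x g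
    rw [Finset.prod_mul_distrib, Finset.prod_ite_mem, Finset.univ_inter, Finset.prod_const]
  have hterm1 : 0 ≤ √(Q / s : ℝ) ^ 3 * ∏ i, (1 / β i : ℝ) := by positivity
  have hterm2 : 0 ≤ max (1 : ℝ) (Q' / s) * ∏ i, (1 / β' i : ℝ) := by positivity
  -- Each long side gains a factor `√(Q / s)` over the old box, and three of them make a summable
  -- power. With at most two, each loses `√(max 1 (Q' / s))` against the new box.
  by_cases hcard : 3 ≤ I.card
  · refine le_trans ?_ (le_add_of_nonneg_right hterm2)
    set x : ℝ := √(Q / s) with hx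
    have hx1 : x ≤ 1 := by
      rw [hx]
      apply Real.sqrt_le_one.2
      exact div_le_one_of_le₀ (by exact_mod_cast hQs) hs0.le
    calc _ ≤ ∏ i, ((if i ∈ I then x else 1) * (1 / β i : ℝ)) := by
          refine Finset.prod_le_prod (fun i _ => by positivity) fun i _ => ?_
          split_ifs with h
          · rw [max_eq_right (one_div_le_one_div_of_le (by positivity) (hmem i h)), hx,
              Real.sqrt_div (by positivity), mul_one_div, div_div, mul_comm, ← div_div]
            gcongr
            rw [le_div_iff₀ (hb i), one_mul]
            apply Real.le_sqrt_of_sq_le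
            exact_mod_cast hQ i
          · rw [one_mul, max_eq_left (one_div_le_one_div_of_le (hb' i) (hnot i h))]
            exact one_div_le_one_div_of_le (hb i) (hbb i)
      _ = x ^ I.card * ∏ i, (1 / β i : ℝ) := hprod _ _
      _ ≤ _ := by
          gcongr ?_ * _
          exact pow_le_pow_of_le_one (by positivity) hx1 hcard
  · refine le_trans ?_ (le_add_of_nonneg_left hterm1)
    set z : ℝ := √(max 1 (Q' / s)) with hz
    have hz1 : 1 ≤ z := Real.one_le_sqrt.2 (le_max_left _ _)
    have hz2 : z ^ 2 = max 1 (Q' / s : ℝ) := Real.sq_sqrt (by positivity)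
    calc _ ≤ ∏ i, ((if i ∈ I then z else 1) * (1 / β' i : ℝ)) := by
          refine Finset.prod_le_prod (fun i _ => by positivity) fun i _ => ?_
          split_ifs with h
          · rw [max_eq_right (one_div_le_one_div_of_le (by positivity) (hmem i h)), mul_one_div,
              div_le_div_iff₀ (by positivity) (hb' i), one_mul]
            apply (sq_le_sq₀ (hb' i).le (by positivity)).1
            rw [mul_pow, hz2, Real.sq_sqrt hs0.le]
            calc (β' i : ℝ) ^ 2 ≤ Q' := by exact_mod_cast hQ' i
              _ = Q' / s * s := by field_simp
              _ ≤ _ := by gcongr; exact le_max_right _ _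
          · rw [one_mul, max_eq_left (one_div_le_one_div_of_le (hb' i) (hnot i h))]
      _ = z ^ I.card * ∏ i, (1 / β' i : ℝ) := hprod _ _
      _ ≤ z ^ 2 * ∏ i, (1 / β' i : ℝ) := by
          gcongr ?_ * _
          exact pow_le_pow_right₀ hz1 (by omega)
      _ = _ := by rw [hz2]

/-- With `V` the volume, these give `1 ≤ log V`, allow inverse sides to be traded for `1 / V` (as
`2β + 1 ≤ 3β`), and bound the logarithm of `∑ β²` by `2 log V`. -/
theorem inv_prod_bounds {d : ℕ} (hd : 1 ≤ d) {β : Fin d → ℕ} (hβ : ∀ i, 1 ≤ β i) :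
    3 ≤ ((boxVerts β).card : ℝ) ∧
    ∏ i, (1 / β i : ℝ) ≤ 3 ^ d / ((boxVerts β).card : ℝ) ∧
    ((∑ i, β i ^ 2 : ℕ) : ℝ) ≤ ((boxVerts β).card : ℝ) ^ 2 := by
  have hb : ∀ i, (1 : ℝ) ≤ β i := fun i => by exact_mod_cast hβ i
  have hcard := card_boxVerts β
  have hpos : (0 : ℝ) < ∏ i, (2 * β i + 1 : ℝ) := Finset.prod_pos fun i _ => by positivity
  refine ⟨?_, ?_, ?_⟩
  · rw [hcard]
    calc (3 : ℝ) = 3 ^ 1 := by norm_num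
      _ ≤ 3 ^ d := pow_le_pow_right₀ (by norm_num) hd
      _ = ∏ _i : Fin d, (3 : ℝ) := by simp
      _ ≤ _ := Finset.prod_le_prod (fun i _ => by norm_num) fun i _ => by linarith [hb i]
  · rw [hcard, le_div_iff₀ hpos, ← Finset.prod_mul_distrib]
    calc _ ≤ ∏ _i : Fin d, (3 : ℝ) := by
          refine Finset.prod_le_prod (fun i _ => by positivity) fun i _ => ?_
          have := hb i
          rw [one_div, inv_mul_le_iff₀ (by linarith)]
          linarith
      _ = _ := by simp
  · rw [hcard, ← Finset.prod_pow]
    push_cast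
    have key : ∀ s : Finset (Fin d),
        1 + ∑ i ∈ s, (β i : ℝ) ^ 2 ≤ ∏ i ∈ s, (2 * β i + 1 : ℝ) ^ 2 := by
      intro s
      induction s using Finset.cons_induction with
      | empty => simp
      | cons i s hi ih =>
        rw [Finset.sum_cons, Finset.prod_cons]
        have h1 : 0 ≤ ∑ i ∈ s, (β i : ℝ) ^ 2 := Finset.sum_nonneg fun _ _ => sq_nonneg _
        have h2 := hb i
        have h3 : (1 + (β i : ℝ) ^ 2) ≤ (2 * β i + 1 : ℝ) ^ 2 := by nlinarith
        calc _ ≤ (1 + (β i : ℝ) ^ 2) * (1 + ∑ i ∈ s, (β i : ℝ) ^ 2) := by nlinarith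
          _ ≤ _ := mul_le_mul h3 ih (by positivity) (by positivity)
    linarith [key Finset.univ]

/-- A sequence that is dominated by the heat kernels of growing boxes, along the phases of
a schedule, is summable. -/
theorem summable_of_le_kernel {d : ℕ} (hd : 1 ≤ d) {β : ℕ → Fin d → ℕ} (hβ : ∀ n i, 1 ≤ β n i)
    (hm : Monotone β) (dur : ℕ → ℕ) {r : ℕ → ℝ} (hr : ∀ t, 0 ≤ r t) {K : ℝ} (hK : 0 ≤ K)
    (hrK : ∀ n t s, ∑ m ∈ Finset.range n, dur m ≤ t → 1 ≤ s →
      r (t + s) ≤ K * ∏ i, max (1 / β n i : ℝ) (1 / √s))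
    (hsum : Summable fun n => max (dur n : ℝ)
      (∑ i, (β n i : ℝ) ^ 2 * Real.log ((boxVerts (β n)).card : ℝ)) /
        ((boxVerts (β n)).card : ℝ)) : Summable r := by
  set a : ℕ → ℝ := fun n => max (dur n : ℝ)
      (∑ i, (β n i : ℝ) ^ 2 * Real.log ((boxVerts (β n)).card : ℝ)) /
        ((boxVerts (β n)).card : ℝ) with ha
  let Q : ℕ → ℕ := fun n => ∑ i, β n i ^ 2
  let A : ℕ → ℝ := fun n => ∏ i, (1 / β n i : ℝ)
  -- Stretched phases, long enough for mixing. They begin no earlier than the true ones, so the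
  -- kernel bound for box `n` still applies from `T' n` on.
  let δ : ℕ → ℕ := fun n => max (dur n) (Q n)
  let T' : ℕ → ℕ := fun n => ∑ m ∈ Finset.range n, δ m
  have hTT : ∀ n, ∑ m ∈ Finset.range n, dur m ≤ T' n :=
    fun n => Finset.sum_le_sum fun m _ => le_max_left _ _
  have hQi : ∀ n i, β n i ^ 2 ≤ Q n := fun n i =>
    Finset.single_le_sum (f := fun i => β n i ^ 2) (fun _ _ => Nat.zero_le _) (Finset.mem_univ i)
  have hQ1 : ∀ n, 1 ≤ Q n := fun n =>
    (Nat.one_le_pow _ _ (hβ n ⟨0, hd⟩)).trans (hQi n ⟨0, hd⟩)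
  have hA0 : ∀ n, 0 ≤ A n := fun n => Finset.prod_nonneg fun i _ => by positivity
  -- The `4` counts `δ ≤ M`, `Q ≤ M` and `Q log Q ≤ 2 M`, with `M` the numerator of `a n`.
  have hbd : ∀ n, Q n * A n ≤ 3 ^ d * a n ∧ (δ n + Q n * (1 + Real.log (Q n))) * A n ≤
      4 * 3 ^ d * a n := by
    intro n
    obtain ⟨h1, h2, h3⟩ := inv_prod_bounds hd (hβ n)
    set V : ℝ := ((boxVerts (β n)).card : ℝ) with hV
    have hV0 : 0 < V := by linarith
    have hlog1 : 1 ≤ Real.log V := by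
      rw [Real.le_log_iff_exp_le hV0]
      linarith [Real.exp_one_lt_three]
    have hQpos : (1 : ℝ) ≤ Q n := by exact_mod_cast hQ1 n
    have hlogQ : Real.log (Q n) ≤ 2 * Real.log V := by
      have := Real.log_le_log (by linarith) h3
      rwa [Real.log_pow, Nat.cast_ofNat] at this
    set M : ℝ := max (dur n : ℝ) (∑ i, (β n i : ℝ) ^ 2 * Real.log V) with hM
    have hM1 : (dur n : ℝ) ≤ M := le_max_left _ _
    have hM2 : Q n * Real.log V ≤ M := by
      refine le_trans (le_of_eq ?_) (le_max_right _ _)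
      rw [← Finset.sum_mul]
      simp only [Q]
      push_cast
      rfl
    have hM3 : (Q n : ℝ) ≤ M := by nlinarith
    have hM0 : 0 ≤ M := by linarith
    have hδ : (δ n : ℝ) ≤ M := by
      simp only [δ, Nat.cast_max]
      exact max_le hM1 hM3
    have haM : 3 ^ d * a n = M * (3 ^ d / V) := by
      simp only [ha]
      ring
    constructor
    · rw [haM]
      exact mul_le_mul hM3 h2 (hA0 n) hM0
    · rw [mul_assoc, haM, ← mul_assoc]
      refine mul_le_mul ?_ h2 (hA0 n) (by positivity)
      nlinarith
  have hphase : ∀ n, ∑ s ∈ Finset.range (δ (n + 1)), r (T' (n + 1) + s) ≤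
      K * 3 ^ d * (7 * a n + 4 * a (n + 1)) := by
    intro n
    have hpt : ∀ s, r (T' (n + 1) + s) ≤ K * ((if s < Q n then (1 : ℝ) else √(Q n / s) ^ 3) * A n +
        max (1 : ℝ) (Q (n + 1) / s) * A (n + 1)) := by
      intro s
      split_ifs with h
      -- Measured from the start of phase `n`, the elapsed time is at least `Q n`, so its root
      -- exceeds every side of the old box.
      · have e : T' (n + 1) + s = T' n + (δ n + s) := by
          simp only [T', Finset.sum_range_succ]
          ring
        have hδ : Q n ≤ δ n := le_max_right _ _
        have := hQ1 n
        rw [e]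
        refine (hrK n (T' n) (δ n + s) (hTT n) (by omega)).trans ?_
        gcongr
        rw [one_mul]
        refine le_add_of_le_of_nonneg ?_ (mul_nonneg (by positivity) (hA0 _))
        refine Finset.prod_le_prod (fun i _ => by positivity) fun i _ => ?_
        refine max_le le_rfl ?_
        have hbi : (0 : ℝ) < β n i := by exact_mod_cast hβ n i
        refine one_div_le_one_div_of_le hbi ?_
        apply Real.le_sqrt_of_sq_le
        have := (hQi n i).trans (hδ.trans (Nat.le_add_right (δ n) s))
        exact_mod_cast this
      · have hs : 1 ≤ s := (hQ1 n).trans (not_lt.1 h)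
        refine (hrK (n + 1) (T' (n + 1)) s (hTT (n + 1)) hs).trans ?_
        gcongr
        exact prod_max_le (hβ n) (hm (Nat.le_succ n)) (hQi n) (hQi (n + 1)) (not_lt.1 h) hs
    calc _ ≤ ∑ s ∈ Finset.range (δ (n + 1)), K *
          ((if s < Q n then (1 : ℝ) else √(Q n / s) ^ 3) * A n +
          max (1 : ℝ) (Q (n + 1) / s) * A (n + 1)) := Finset.sum_le_sum fun s _ => hpt s
      _ = K * ((∑ s ∈ Finset.range (δ (n + 1)),
            if s < Q n then (1 : ℝ) else √(Q n / s) ^ 3) * A n +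
          (∑ s ∈ Finset.range (δ (n + 1)), max (1 : ℝ) (Q (n + 1) / s)) * A (n + 1)) := by
          rw [← Finset.mul_sum, Finset.sum_add_distrib, Finset.sum_mul, Finset.sum_mul]
      _ ≤ K * (7 * Q n * A n +
          (δ (n + 1) + Q (n + 1) * (1 + Real.log (Q (n + 1)))) * A (n + 1)) := by
          gcongr
          · exact sum_cutoff_sqrt_cube_le (hQ1 n) _
          · exact sum_max_one_div_le _ _
      _ ≤ K * (7 * (3 ^ d * a n) + 4 * 3 ^ d * a (n + 1)) := by
          gcongr ?_ * (?_ + ?_)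
          · rw [mul_assoc]
            exact mul_le_mul_of_nonneg_left (hbd n).1 (by norm_num)
          · exact (hbd (n + 1)).2
      _ = _ := by ring
  have ha0 : ∀ n, 0 ≤ a n := fun n => by
    simp only [ha]
    positivity
  -- The initial stretched phase has no predecessor and stays as a finite constant.
  have hT'sum : ∀ n, ∑ t ∈ Finset.range (T' (n + 1)), r t ≤ ∑ t ∈ Finset.range (T' 1), r t +
      K * 3 ^ d * ∑ m ∈ Finset.range n, (7 * a m + 4 * a (m + 1)) := by
    intro n
    induction n with
    | zero => simp
    | succ n ih =>
      have e : T' (n + 1 + 1) = T' (n + 1) + δ (n + 1) := Finset.sum_range_succ _ _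
      rw [e, Finset.sum_range_add, Finset.sum_range_succ, mul_add]
      linarith [hphase n]
  have hs : Summable fun m => 7 * a m + 4 * a (m + 1) :=
    (hsum.mul_left 7).add (((summable_nat_add_iff 1).2 hsum).mul_left 4)
  refine summable_of_sum_range_le (c := ∑ t ∈ Finset.range (T' 1), r t +
      K * 3 ^ d * ∑' m, (7 * a m + 4 * a (m + 1))) hr fun n => ?_
  have hnT : n ≤ T' (n + 1) := by
    have : ∑ m ∈ Finset.range (n + 1), 1 ≤ T' (n + 1) :=
      Finset.sum_le_sum fun m _ => (hQ1 m).trans (le_max_right _ _)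
    simp at this
    omega
  calc _ ≤ ∑ t ∈ Finset.range (T' (n + 1)), r t :=
        Finset.sum_le_sum_of_subset_of_nonneg (Finset.range_subset_range.2 hnT) fun t _ _ => hr t
    _ ≤ _ := hT'sum n
    _ ≤ _ := by
        gcongr
        exact hs.sum_le_tsum _ fun m _ => by
          have := ha0 m
          have := ha0 (m + 1)
          positivity

/-! ### Recurrence and transience -/

theorem tsum_ofReal_eq_top {r : ℕ → ℝ} (hr : ∀ t, 0 ≤ r t) (k : ℕ → ℕ) {S : ℕ → ℝ}
    (hS : Tendsto S atTop atTop) (h : ∀ n, S n ≤ ∑ t ∈ Finset.range (k n), r t) :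
    ∑' t, ENNReal.ofReal (r t) = ⊤ := by
  by_contra hne
  obtain ⟨n, hn⟩ := (hS.eventually_gt_atTop (∑' t, ENNReal.ofReal (r t)).toReal).exists
  have h1 := ENNReal.sum_le_tsum (f := fun t => ENNReal.ofReal (r t)) (Finset.range (k n))
  rw [← ENNReal.ofReal_sum_of_nonneg fun t _ => hr t] at h1
  have h2 := (ENNReal.ofReal_le_iff_le_toReal hne).1 h1
  linarith [h n]

theorem theorem5p4 {d : ℕ} (hd : 1 ≤ d) (b : Fin d → ℕ → ℕ)
    (hb : ∀ i n, 1 ≤ n → 1 ≤ b i n) (hmono : ∀ i m n, 1 ≤ m → m ≤ n → b i m ≤ b i n)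
    (dur : ℕ → ℕ)
    -- the phases cover all times, so that the walk is defined for every `t`
    (hT : Tendsto (boxWalk hd b hb hmono dur).T atTop atTop)
    {Ω : Type*} [MeasurableSpace Ω] (μ : Measure Ω) [IsProbabilityMeasure μ]
    (X : ℕ → Ω → (Fin d → ℤ)) (hX : (boxWalk hd b hb hmono dur).IsWalk μ X 0) :
    (Tendsto (fun N : ℕ => ∑ n ∈ Finset.Icc 1 N,
        ((dur n : ℝ) - 1) / ((boxVerts fun i => b i n).card : ℝ)) atTop atTop →
      IsRecurrentAt μ X 0) ∧
    (Summable (fun n : ℕ =>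
        max (dur (n + 1) : ℝ)
          (∑ i, (b i (n + 1) : ℝ) ^ 2 * Real.log ((boxVerts fun i => b i (n + 1)).card : ℝ)) /
          ((boxVerts fun i => b i (n + 1)).card : ℝ)) →
      IsTransientAt μ X 0) := by
  set T : ℕ → ℕ := (boxWalk hd b hb hmono dur).T with hTdef
  have hT_eq : ∀ n, T n = ∑ m ∈ Finset.range n, dur (m + 1) := by
    intro n
    have : T n = ∑ i ∈ Finset.Icc 1 n, dur i := rfl
    rw [this, ← Finset.Ico_add_one_right_eq_Icc, Finset.sum_Ico_eq_sum_range]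
    simp [add_comm]
  have hT_succ : ∀ n, T (n + 1) = T n + dur (n + 1) := by
    intro n
    rw [hT_eq, hT_eq, Finset.sum_range_succ]
  have hT_mono : Monotone T := monotone_nat_of_le_succ fun n => by rw [hT_succ]; omega
  obtain ⟨N, hN, hNT⟩ := exists_phase (by rw [hT_eq]; rfl) hT_mono hT
  let β : ℕ → Fin d → ℕ := fun n i => b i (n + 1)
  have hβ : ∀ n i, 1 ≤ β n i := fun n i => hb i (n + 1) (by omega)
  have hβm : Monotone β := fun m n h i => hmono i _ _ (by omega) (by omega)
  let c : ℕ → Fin d → ℕ := fun t => β (N t)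
  have hc : ∀ t i, 1 ≤ c t i := fun t => hβ (N t)
  have hcm : Monotone c := hβm.comp hN
  have hR := measure_eq_boxIter hX.measurable hX.start hc hcm fun t x =>
    hX.step (N t) t (hNT t).1 (hNT t).2 x
  set r : ℕ → ℝ := fun t => boxIter c t (Pi.single 0 1) 0 with hr
  have hr0 : ∀ t, 0 ≤ r t := fun t => by
    rw [hr]
    simp only [← hR]
    positivity
  have hRr : ∀ t, μ {ω | X t ω = 0} = ENNReal.ofReal (r t) := fun t => by
    rw [hr]
    simp only [← hR]
    exact (ofReal_measureReal (measure_ne_top _ _)).symm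
  constructor
  · intro hdiv
    unfold IsRecurrentAt
    simp only [hRr]
    refine tsum_ofReal_eq_top (fun t => hr0 (t + 1)) T
      (hdiv.const_mul_atTop (show (0 : ℝ) < 1 / 2 by norm_num)) fun n => ?_
    induction n with
    | zero =>
      rw [hT_eq]
      simp
    | succ n ih =>
      rw [hT_succ, Finset.sum_range_add, Finset.sum_Icc_succ_top (by omega), mul_add]
      refine add_le_add ih ?_
      -- The times are `T n + 1 + j`: the last step before such a time starts at `T n + j`, hence is
      -- taken in box `β n`.
      have hphase := sub_one_mul_le_sum_range (w := 1 / ((boxVerts (β n)).card : ℝ))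
        (by positivity) (fun j => hr0 (T n + j + 1)) (T n + 1) (dur (n + 1)) ?_
      · rw [mul_one_div] at hphase
        change 1 / 2 * (((dur (n + 1) : ℝ) - 1) / ((boxVerts (β n)).card : ℝ)) ≤ _
        linarith
      · intro j hj heven
        have hNj : N (T n + j) = n := by
          have h1 := hNT (T n + j)
          have h2 : n < N (T n + j) + 1 := by
            by_contra! h
            have := hT_mono h
            omega
          have h3 : N (T n + j) < n + 1 := by
            by_contra! h
            have := hT_mono h
            rw [hT_succ] at this
            omega
          omega
        have hlow := le_boxIter_single hd hc hcm (t := T n + j)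
          (by rwa [add_right_comm] at heven)
        refine le_trans ?_ hlow
        have hcn : c (T n + j) = β n := by simp only [c, hNj]
        rw [hcn, card_boxVerts, one_div]
        have hpos : ∀ i, (0 : ℝ) < β n i := fun i => by exact_mod_cast hβ n i
        refine inv_anti₀ (Finset.prod_pos fun i _ => by linarith [hpos i]) ?_
        exact Finset.prod_le_prod (fun i _ => by linarith [hpos i]) fun i _ => by linarith
  · intro hsum
    have hs : Summable r := by
      refine summable_of_le_kernel hd hβ hβm (fun n => dur (n + 1)) hr0
        (K := (9 * (1 + d) : ℝ) ^ d) (by positivity) ?_ hsum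
      intro n t s ht hs
      refine (boxIter_single_le_kernel hd hc hcm t hs).trans ?_
      -- From time `T n` on, the current box contains `β n`.
      have hn : n ≤ N t := by
        by_contra! h
        have h1 := hT_mono (show N t + 1 ≤ n by omega)
        have h2 := (hNT t).2
        rw [hT_eq n] at h1
        omega
      gcongr with i
      · exact_mod_cast hβ n i
      · exact hβm hn i
    unfold IsTransientAt
    simp only [hRr]
    rw [← ENNReal.ofReal_tsum_of_nonneg hr0 hs]
    exact ENNReal.ofReal_lt_top
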